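/- **Setting.** Let $d\in\{2,3\}$. Consider a Bethe–Weyl fluid at constant specific entropy $s$, i.e. a fluid with a complete state law $e(v,s)$ ($v=1/\rho>0$ the specific volume), bounded below, whose pressure $p=-\partial_v e$ and temperature $T=\partial_s e$ are positive, whose coefficients $\gamma=-\frac vp\partial_vp$, $\Gamma=-\frac vT\partial_vT$, $\delta=\frac{pv}{T^2}\partial_sT$, $\mathscr G=-\frac v2\,\partial_v^3e/\partial_v^2e$ satisfy $\gamma>0$, $\gamma\delta\ge\Gamma^2$, $\Gamma>0$, $\mathscr G>0$, and for which $p\to+\infty$ as $\rho$ tends to a maximal density $\rho_{\max}\in\,]0,+\infty]$. Assume moreover $1<\mathscr G<2$ and that $\rho\mapsto c(\rho)/\rho$ is integrable at $0$, where $c=\sqrt{\partial p/\partial\rho}$ (and $c=0$ in vacuum). Let $H(\rho)=\int_0^\rho \frac{c(x)}{x}\,dx$ and consider the system $$\partial_t\rho+\partial_r(\rho u)=-\frac{(d-1)\rho u}{r},\qquad \partial_tu+u\,\partial_ru+\frac{p'(\rho)}{\rho}\,\partial_r\rho=0,$$ with Riemann invariants $w_1=u-H(\rho)$, $w_2=u+H(\rho)$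 and characteristic speeds $\lambda_1=u-c$, $\lambda_2=u+c$. A regular solution has $0\le\rho<\rho_{\max}$ and $C^1$ Riemann invariants (where $\rho=0$ the system is read as $\partial_tu+u\partial_ru=0$). Let $R_0,T>0$, and let $\mathcal C_1=\{r=x_1(t)\}$, $\mathcal K=\{r=x_2(t)\}$, $0\le t<T$, be curves with $x_1(0)=x_2(0)=R_0$ and $x_1<x_2$ for $t>0$. Put $D_-=\{0<r\le x_1(t)\}$, $D_0=\{x_1(t)\le r\le x_2(t)\}$, $D_+=\{r\ge x_2(t)\}$ (with $0\le t<T$). Let $(\rho^-,u^-)$ be defined on $D_-\cup D_0$, continuous across $\mathcal C_1$ and a regular solution on $D_-$ and on $D_0$, and let $(\rho^+,u^+)$ be a regular solution on $D_+$, such that $x_1'=\lambda_1(w^-)$ on $\mathcal C_1$ and such that on $\mathcal K$ one has $\rho^\pm>0$ and, with $U=x_2'$, the jump conditions $$U(\rho^+-\rho^-)=\rho^+u^+-\rho^-u^-,\qquad u^--u^+=\sqrt{(p^+-p^-)\Big(\frac1{\rho^-}-\frac1{\rho^+}\Big)} .$$ The condition $\rho^->\rho^+$ is required only at $t=0$,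 $r=R_0$. A subscript $0$ denotes values at $t=0$. Assume $\inf_{0<r\le R_0}w_{1,0}^->0$ and that for some $C_0>0$: $|\partial_rw_2^-|\le C_0/r$ in $D_-$, and $\partial_rw_1^+\ge -C_0/r$, $\partial_rw_2^+\le C_0/r$ in $D_+$. Put $a=w_{1,0}^-(R_0)$, and assume that $m=\inf_{r\ge R_0}w_{1,0}^+$ and $M=\sup_{r\ge R_0}w_{2,0}^+$ are finite. **Proposition.** Assume in addition $$a+m>0,\qquad a>M .$$ Then there is a constant $C>0$, depending only on $d,a,m,M$ (in particular not on $R_0$ or $T$), such that for every $t\in[0,\min(T,CR_0)[$: 1. $\rho^+(t,x_2(t))<\rho^-(t,x_2(t))$; 2. the $C^0$ estimates hold at every point $(t,r)\in D_0$: there are a 1-characteristic $X_1$ in $D_0$ going from a point $(\alpha,x_2(\alpha))$ of $\mathcal K$ to $(t,r)$ and a 2-characteristic $X_2$ in $D_0$ going from a point $(\beta,x_1(\beta))$ of $\mathcal C_1$ to $(t,r)$, with $0\le\alpha,\beta\le t$; one has $w_1^-(t,r)\le w_2^-(t,r)$; and for all such characteristics $$w_1^-(\alpha,x_2(\alpha))\le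 w_1^-(t,r)\le w_1^-(\alpha,x_2(\alpha))+\Big(\sup_{\tau\in[0,t]}|w_2^-(\tau,x_1(\tau))|\Big)^2\int_\alpha^t\frac{d-1}{4X_1(\tau)}\,d\tau ,$$ $$\frac{w_2^-(\beta,x_1(\beta))}{1+\frac{w_2^-(\beta,x_1(\beta))}{x_1(\beta)}\,\frac{(d-1)(t-\beta)}{4}}\le w_2^-(t,r)\le w_2^-(\beta,x_1(\beta)).$$ -/

import Mathlib

open Set Filter Topology MeasureTheory

noncomputable section

namespace RadialShock

/-! ### Thermodynamics: a complete state law `e v s` (specific volume `v`, specific entropy `s`) -/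

/-- Pressure `p = - ∂e/∂v` at constant entropy. -/
def pressure (e : ℝ → ℝ → ℝ) (v s : ℝ) : ℝ := - deriv (fun x => e x s) v

/-- Temperature `T = ∂e/∂s` at constant volume. -/
def temperature (e : ℝ → ℝ → ℝ) (v s : ℝ) : ℝ := deriv (fun y => e v y) s

/-- Adiabatic exponent `γ = - (v / p) ∂p/∂v`. -/
def adiabaticExponent (e : ℝ → ℝ → ℝ) (v s : ℝ) : ℝ :=
  - (v / pressure e v s) * deriv (fun x => pressure e x s) v

/-- Grüneisen coefficient `Γ = - (v / T) ∂T/∂v`. -/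
def grueneisen (e : ℝ → ℝ → ℝ) (v s : ℝ) : ℝ :=
  - (v / temperature e v s) * deriv (fun x => temperature e x s) v

/-- The coefficient `δ = (p v / T²) ∂T/∂s`. -/
def deltaCoeff (e : ℝ → ℝ → ℝ) (v s : ℝ) : ℝ :=
  pressure e v s * v / temperature e v s ^ 2 * deriv (fun y => temperature e v y) s

/-- The coefficient `𝒢 = - (v / 2) (∂³e/∂v³) / (∂²e/∂v²)`. -/
def scrG (e : ℝ → ℝ → ℝ) (v s : ℝ) : ℝ :=
  - (v / 2) * (iteratedDeriv 3 (fun x => e x s) v / iteratedDeriv 2 (fun x => e x s) v)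

/-- Bethe–Weyl fluid. The state law is defined for `v > vMin` and `s` in the open set `S`;
`vMin = 1 / ρ_max`, so that `vMin = 0` stands for `ρ_max = +∞`, and `ρ → ρ_max` reads
`v → vMin` from the right. -/
structure IsBetheWeyl (e : ℝ → ℝ → ℝ) (vMin : ℝ) (S : Set ℝ) : Prop where
  vMin_nonneg : 0 ≤ vMin
  isOpen_entropy : IsOpen S
  regular : ContDiffOn ℝ 3 (fun z : ℝ × ℝ => e z.1 z.2) (Ioi vMin ×ˢ S)
  bounded_below : ∃ B : ℝ, ∀ v ∈ Ioi vMin, ∀ s ∈ S, B ≤ e v s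
  pressure_pos : ∀ v ∈ Ioi vMin, ∀ s ∈ S, 0 < pressure e v s
  temperature_pos : ∀ v ∈ Ioi vMin, ∀ s ∈ S, 0 < temperature e v s
  gamma_pos : ∀ v ∈ Ioi vMin, ∀ s ∈ S, 0 < adiabaticExponent e v s
  gamma_delta : ∀ v ∈ Ioi vMin, ∀ s ∈ S,
    grueneisen e v s ^ 2 ≤ adiabaticExponent e v s * deltaCoeff e v s
  grueneisen_pos : ∀ v ∈ Ioi vMin, ∀ s ∈ S, 0 < grueneisen e v s
  scrG_pos : ∀ v ∈ Ioi vMin, ∀ s ∈ S, 0 < scrG e v s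
  pressure_lim : ∀ s ∈ S, Tendsto (fun v => pressure e v s) (𝓝[>] vMin) atTop

/-! ### Isentropic flow: the entropy `s` is a constant, the density `ρ = 1 / v` the variable -/

/-- Pressure as a function of the density. -/
def press (e : ℝ → ℝ → ℝ) (s ρ : ℝ) : ℝ := pressure e (1 / ρ) s

/-- Adiabatic sound speed `c = √(∂p/∂ρ)`, extended by its limit `0` to the vacuum. -/
def soundSpeed (e : ℝ → ℝ → ℝ) (s ρ : ℝ) : ℝ :=
  if 0 < ρ then √(deriv (press e s) ρ) else 0

/-- The primitive `H` of `ρ ↦ c(ρ) / ρ` that vanishes at `0`. -/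
def primH (e : ℝ → ℝ → ℝ) (s ρ : ℝ) : ℝ := ∫ x in (0 : ℝ)..ρ, soundSpeed e s x / x

/-- The gas satisfies `1 < 𝒢 < 2` and `ρ ↦ c(ρ) / ρ` is integrable at `0`. -/
structure IsAdmissibleGas (e : ℝ → ℝ → ℝ) (vMin s : ℝ) : Prop where
  scrG_mem : ∀ v ∈ Ioi vMin, scrG e v s ∈ Ioo (1 : ℝ) 2
  integrable_zero : IntegrableAtFilter (fun ρ => soundSpeed e s ρ / ρ) (𝓝[>] (0 : ℝ)) volume

/-- A radial flow: density and radial velocity as functions of time and radius. -/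
structure Flow where
  ρ : ℝ → ℝ → ℝ
  u : ℝ → ℝ → ℝ

/-- Riemann invariant `w₁ = u - H(ρ)`. -/
def Flow.w₁ (F : Flow) (e : ℝ → ℝ → ℝ) (s t r : ℝ) : ℝ := F.u t r - primH e s (F.ρ t r)

/-- Riemann invariant `w₂ = u + H(ρ)`. -/
def Flow.w₂ (F : Flow) (e : ℝ → ℝ → ℝ) (s t r : ℝ) : ℝ := F.u t r + primH e s (F.ρ t r)

/-- Characteristic speed `λ₁ = u - c`. -/
def Flow.speed₁ (F : Flow) (e : ℝ → ℝ → ℝ) (s t r : ℝ) : ℝ :=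
  F.u t r - soundSpeed e s (F.ρ t r)

/-- Characteristic speed `λ₂ = u + c`. -/
def Flow.speed₂ (F : Flow) (e : ℝ → ℝ → ℝ) (s t r : ℝ) : ℝ :=
  F.u t r + soundSpeed e s (F.ρ t r)

/-- `F` is a regular solution, on the set `D` of points `(t, r)`, of the isentropic Euler system
with symmetry of dimension `d`: the density lies in `[0, ρ_max)`, the Riemann invariants are `C¹`
on `D` (up to the part of the boundary that belongs to `D`) and the system holds inside `D`.
In the vacuum the pressure term `(p'(ρ) / ρ) ∂ᵣρ = c ∂ᵣH(ρ)` vanishes and the mass equation is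
void. -/
structure IsRegularSolution (e : ℝ → ℝ → ℝ) (vMin s : ℝ) (d : ℕ) (F : Flow)
    (D : Set (ℝ × ℝ)) : Prop where
  density_nonneg : ∀ z ∈ D, 0 ≤ F.ρ z.1 z.2
  density_lt_max : ∀ z ∈ D, F.ρ z.1 z.2 * vMin < 1
  contDiffOn_w₁ : ContDiffOn ℝ 1 (fun z : ℝ × ℝ => F.w₁ e s z.1 z.2) D
  contDiffOn_w₂ : ContDiffOn ℝ 1 (fun z : ℝ × ℝ => F.w₂ e s z.1 z.2) D
  mass : ∀ t r : ℝ, (t, r) ∈ interior D → 0 < F.ρ t r →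
    deriv (fun τ => F.ρ τ r) t + deriv (fun x => F.ρ t x * F.u t x) r
      = - (((d : ℝ) - 1) * F.ρ t r * F.u t r) / r
  momentum : ∀ t r : ℝ, (t, r) ∈ interior D → 0 < F.ρ t r →
    deriv (fun τ => F.u τ r) t + F.u t r * deriv (fun x => F.u t x) r
      + deriv (press e s) (F.ρ t r) / F.ρ t r * deriv (fun x => F.ρ t x) r = 0
  momentum_vacuum : ∀ t r : ℝ, (t, r) ∈ interior D → F.ρ t r = 0 →
    deriv (fun τ => F.u τ r) t + F.u t r * deriv (fun x => F.u t x) r = 0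

/-! ### The geometry: `D₋`, the angular domain `D₀`, and `D₊` -/

/-- The domain to the left of the curve `r = x₁(t)`. -/
def domMinus (T : ℝ) (x₁ : ℝ → ℝ) : Set (ℝ × ℝ) :=
  {z | z.1 ∈ Ico 0 T ∧ z.2 ∈ Ioc 0 (x₁ z.1)}

/-- The angular domain between the curves `r = x₁(t)` and `r = x₂(t)`. -/
def domZero (T : ℝ) (x₁ x₂ : ℝ → ℝ) : Set (ℝ × ℝ) :=
  {z | z.1 ∈ Ico 0 T ∧ z.2 ∈ Icc (x₁ z.1) (x₂ z.1)}

/-- The domain to the right of the curve `r = x₂(t)`. -/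
def domPlus (T : ℝ) (x₂ : ℝ → ℝ) : Set (ℝ × ℝ) :=
  {z | z.1 ∈ Ico 0 T ∧ z.2 ∈ Ici (x₂ z.1)}

/-- A solution, on the time interval `[0, T)`, of the free boundary problem with a discontinuity
issued from `R₀`. The flow `L` lives on the left of the curve `r = x₂(t)`: it is continuous there
and regular on each side of the 1-characteristic `r = x₁(t)` issued from `R₀`. The flow `P` is
regular on the right. Along `r = x₂(t)`, which moves with speed `U`, the two jump conditions
`U (ρ⁺ - ρ⁻) = ρ⁺ u⁺ - ρ⁻ u⁻` and `u⁻ - u⁺ = √((p⁺ - p⁻) (1/ρ⁻ - 1/ρ⁺))` hold. The third one,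
`ρ⁻ > ρ⁺`, is required only at the initial time. -/
structure IsShockFlow (e : ℝ → ℝ → ℝ) (vMin s : ℝ) (d : ℕ) (R₀ T : ℝ) (x₁ x₂ U : ℝ → ℝ)
    (L P : Flow) : Prop where
  start₁ : x₁ 0 = R₀
  start₂ : x₂ 0 = R₀
  lt : ∀ t ∈ Ioo 0 T, x₁ t < x₂ t
  regular_minus : IsRegularSolution e vMin s d L (domMinus T x₁)
  regular_zero : IsRegularSolution e vMin s d L (domZero T x₁ x₂)
  regular_plus : IsRegularSolution e vMin s d P (domPlus T x₂)
  characteristic : ∀ t ∈ Ico 0 T, HasDerivWithinAt x₁ (L.speed₁ e s t (x₁ t)) (Ico 0 T) t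
  shock_curve : ∀ t ∈ Ico 0 T, HasDerivWithinAt x₂ (U t) (Ico 0 T) t
  density_left_pos : ∀ t ∈ Ico 0 T, 0 < L.ρ t (x₂ t)
  density_right_pos : ∀ t ∈ Ico 0 T, 0 < P.ρ t (x₂ t)
  jump_mass : ∀ t ∈ Ico 0 T, U t * (P.ρ t (x₂ t) - L.ρ t (x₂ t))
      = P.ρ t (x₂ t) * P.u t (x₂ t) - L.ρ t (x₂ t) * L.u t (x₂ t)
  jump_velocity : ∀ t ∈ Ico 0 T, L.u t (x₂ t) - P.u t (x₂ t)
      = √((press e s (P.ρ t (x₂ t)) - press e s (L.ρ t (x₂ t)))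
            * (1 / L.ρ t (x₂ t) - 1 / P.ρ t (x₂ t)))
  initial_compression : P.ρ 0 R₀ < L.ρ 0 R₀

/-- `X` is, on the time interval `[α, t]`, an integral curve of the speed `c` contained in `D`. -/
def IsCharacteristic (c : ℝ → ℝ → ℝ) (D : Set (ℝ × ℝ)) (X : ℝ → ℝ) (α t : ℝ) : Prop :=
  ∀ τ ∈ Icc α t, (τ, X τ) ∈ D ∧ HasDerivWithinAt X (c τ (X τ)) (Icc α t) τ

/-- `X` is a 1-characteristic in `D₀` that leaves the curve `r = x₂` at time `α` and arrives at
`(t, r)`. -/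
def IsChar₁ (e : ℝ → ℝ → ℝ) (s T : ℝ) (x₁ x₂ : ℝ → ℝ) (L : Flow) (X : ℝ → ℝ) (α t r : ℝ) :
    Prop :=
  α ∈ Icc 0 t ∧ X α = x₂ α ∧ X t = r ∧ IsCharacteristic (L.speed₁ e s) (domZero T x₁ x₂) X α t

/-- `X` is a 2-characteristic in `D₀` that leaves the curve `r = x₁` at time `β` and arrives at
`(t, r)`. -/
def IsChar₂ (e : ℝ → ℝ → ℝ) (s T : ℝ) (x₁ x₂ : ℝ → ℝ) (L : Flow) (X : ℝ → ℝ) (β t r : ℝ) :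
    Prop :=
  β ∈ Icc 0 t ∧ X β = x₁ β ∧ X t = r ∧ IsCharacteristic (L.speed₂ e s) (domZero T x₁ x₂) X β t

/-- The `C⁰` estimates at the point `(t, r)` of `D₀`, along the characteristics through `(t, r)`,
which are followed back to the boundary of `D₀`. The norm of the incoming data `w₂` is the supremum
of `|w₂|` on the curve `r = x₁` up to time `t`. -/
structure C0Estimates (e : ℝ → ℝ → ℝ) (s : ℝ) (d : ℕ) (T : ℝ) (x₁ x₂ : ℝ → ℝ) (L : Flow)
    (t r : ℝ) : Prop where
  exists_char₁ : ∃ α X, IsChar₁ e s T x₁ x₂ L X α t r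
  exists_char₂ : ∃ β X, IsChar₂ e s T x₁ x₂ L X β t r
  w₁_le_w₂ : L.w₁ e s t r ≤ L.w₂ e s t r
  w₁_lower : ∀ α X, IsChar₁ e s T x₁ x₂ L X α t r → L.w₁ e s α (x₂ α) ≤ L.w₁ e s t r
  w₁_upper : ∀ α X, IsChar₁ e s T x₁ x₂ L X α t r →
    L.w₁ e s t r ≤ L.w₁ e s α (x₂ α)
      + sSup ((fun τ => |L.w₂ e s τ (x₁ τ)|) '' Icc 0 t) ^ 2
        * ∫ τ in α..t, ((d : ℝ) - 1) / (4 * X τ)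
  w₂_lower : ∀ β X, IsChar₂ e s T x₁ x₂ L X β t r →
    L.w₂ e s β (x₁ β)
        / (1 + L.w₂ e s β (x₁ β) / x₁ β * (((d : ℝ) - 1) * (t - β) / 4))
      ≤ L.w₂ e s t r
  w₂_upper : ∀ β X, IsChar₂ e s T x₁ x₂ L X β t r → L.w₂ e s t r ≤ L.w₂ e s β (x₁ β)

end RadialShock

end

/-!
With `c` the sound speed and `H' = c / ρ`, the system is a pair of transport equations with opposite
sources,

  `∂ₜw₁ + (u - c) ∂ᵣw₁ = (d - 1) c u / r`,  `∂ₜw₂ + (u + c) ∂ᵣw₂ = -(d - 1) c u / r`.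

Since `dc/dH = 𝒢 - 1` lies in `(0, 1)`, one has `0 ≤ c ≤ H = (w₂ - w₁) / 2`, and `c` is a
`1`-Lipschitz function of `H` (`abs_soundSpeed_sub_le`). Hence `w₁ ≤ u - c ≤ u + c ≤ w₂`, and
`-w₁² / 4 ≤ c u` where `u ≤ 0`, `c u ≤ w₂² / 4` everywhere: this is all that is used of the state
law in the smooth regions, and the reason why the constant does not depend on it. On a shock with
`ρ⁺ < ρ⁻`, convexity of the isentrope gives Lax's inequalities `u⁺ + c⁺ < U < u⁻ + c⁻`
(`lax_inequalities`) and the Cauchy–Schwarz inequality gives `w₁⁻ ≥ w₁⁺` (`primH_sub_le_sqrt`).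

The `C⁰` estimates follow once `w₂` and `u` are positive in `D₀` and Lax's inequalities hold
(`IsShockFlow.c0Estimates`). A characteristic traced back in `D₀` leaves through the expected side:
the curve `r = x₁` is itself a 1-characteristic, and 2-characteristics are faster than the shock.
Along a characteristic `w₁` increases with slope at most `(d - 1) w₂² / (4 r)`, and `w₂` decreases
and satisfies Riccati's inequality `w₂' ≥ -(d - 1) w₂² / (4 r)`.

Positivity is an a priori bound. The curve `r = x₁` moves outward, with `w₁ ≥ a > 0` on it
(`IsShockFlow.monotone_left`), so that all radii of interest are at least `R₀`. For a constant `K`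
depending only on `a` and `m`, and as long as `ρ⁺ < ρ⁻` on the shock, barriers that are linear in
time with slope `K² / R₀` show in turn that `w₁⁺` stays close to being at least `m`, `w₂⁺` to being
at most `M`, `w₂⁻` to being at least `a`, and `w₁⁻` to being at least `m` (`lower_barrier`,
`IsShockFlow.bounds_plus`, `IsShockFlow.bounds_zero`). As `a + m > 0`, `u⁻` is positive. As `a > M`,
`w₂⁻` and `w₂⁺` cannot become equal on the shock, so that the jump of density cannot vanish, and the
bounds persist up to a time proportional to `R₀` (`IsShockFlow.density_lt`).
-/

namespace RadialShock

/-! ### The sound speed and the function `H` -/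

section Gas

variable {e : ℝ → ℝ → ℝ} {vMin s : ℝ} {S : Set ℝ}

lemma IsBetheWeyl.contDiffAt (hB : IsBetheWeyl e vMin S) (hs : s ∈ S) {v : ℝ} (hv : vMin < v) :
    ContDiffAt ℝ 3 (fun x => e x s) v := by
  have h : ContDiffAt ℝ 3 (fun z : ℝ × ℝ => e z.1 z.2) (v, s) :=
    hB.regular.contDiffAt ((isOpen_Ioi.prod hB.isOpen_entropy).mem_nhds ⟨hv, hs⟩)
  exact h.comp v (f := fun x : ℝ => (x, s)) (by fun_prop)

lemma IsBetheWeyl.differentiableAt_iteratedDeriv (hB : IsBetheWeyl e vMin S) (hs : s ∈ S) {v : ℝ}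
    (hv : vMin < v) {k : ℕ} (hk : k < 3) :
    DifferentiableAt ℝ (iteratedDeriv k (fun x => e x s)) v := by
  have h := (hB.contDiffAt hs hv).contDiffWithinAt (s := univ)
  have h2 := h.differentiableWithinAt_iteratedDerivWithin (m := k) (by exact_mod_cast hk)
    (by simp)
  rwa [iteratedDerivWithin_univ, differentiableWithinAt_univ] at h2

lemma IsBetheWeyl.hasDerivAt_pressure (hB : IsBetheWeyl e vMin S) (hs : s ∈ S) {v : ℝ}
    (hv : vMin < v) :
    HasDerivAt (fun x => pressure e x s) (-iteratedDeriv 2 (fun x => e x s) v) v := by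
  have h := hB.differentiableAt_iteratedDeriv hs hv (k := 1) (by norm_num)
  have h2 := h.hasDerivAt.neg
  rw [← iteratedDeriv_succ] at h2
  simp only [iteratedDeriv_one] at h2
  exact h2

lemma IsBetheWeyl.hasDerivAt_iteratedDeriv_two (hB : IsBetheWeyl e vMin S) (hs : s ∈ S) {v : ℝ}
    (hv : vMin < v) :
    HasDerivAt (iteratedDeriv 2 (fun x => e x s)) (iteratedDeriv 3 (fun x => e x s) v) v := by
  have h := hB.differentiableAt_iteratedDeriv hs hv (k := 2) (by norm_num)
  have h2 := h.hasDerivAt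
  rwa [← iteratedDeriv_succ] at h2

lemma IsBetheWeyl.iteratedDeriv_two_pos (hB : IsBetheWeyl e vMin S) (hs : s ∈ S) {v : ℝ}
    (hv : vMin < v) : 0 < iteratedDeriv 2 (fun x => e x s) v := by
  have hg := hB.gamma_pos v hv s hs
  have hp := hB.pressure_pos v hv s hs
  have hv0 : 0 < v := hB.vMin_nonneg.trans_lt hv
  rw [adiabaticExponent, (hB.hasDerivAt_pressure hs hv).deriv, neg_mul_neg] at hg
  exact pos_of_mul_pos_right hg (by positivity)

lemma IsBetheWeyl.iteratedDeriv_three_neg (hB : IsBetheWeyl e vMin S) (hs : s ∈ S) {v : ℝ}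
    (hv : vMin < v) : iteratedDeriv 3 (fun x => e x s) v < 0 := by
  have hg := hB.scrG_pos v hv s hs
  have hv0 : 0 < v := hB.vMin_nonneg.trans_lt hv
  have h2 := hB.iteratedDeriv_two_pos hs hv
  by_contra! h3
  have : 0 ≤ v / 2 * (iteratedDeriv 3 (fun x => e x s) v / iteratedDeriv 2 (fun x => e x s) v) := by
    positivity
  rw [scrG] at hg
  linarith

/-- The slope `-∂p/∂v` is strictly decreasing: the isentrope is strictly convex. -/
lemma IsBetheWeyl.strictAntiOn_iteratedDeriv_two (hB : IsBetheWeyl e vMin S) (hs : s ∈ S) :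
    StrictAntiOn (iteratedDeriv 2 (fun x => e x s)) (Ioi vMin) := by
  refine strictAntiOn_of_deriv_neg (convex_Ioi _) (fun v hv =>
    (hB.hasDerivAt_iteratedDeriv_two hs hv).continuousAt.continuousWithinAt) fun v hv => ?_
  rw [interior_Ioi] at hv
  rw [(hB.hasDerivAt_iteratedDeriv_two hs hv).deriv]
  exact hB.iteratedDeriv_three_neg hs hv

/-- The admissible densities `0 ≤ ρ < ρ_max`, where `ρ_max = 1 / vMin`. -/
def densities (vMin : ℝ) : Set ℝ := {ρ | 0 ≤ ρ ∧ ρ * vMin < 1}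

lemma lt_one_div_of_mem {ρ : ℝ} (h : ρ ∈ densities vMin) (h0 : 0 < ρ) : vMin < 1 / ρ := by
  rw [lt_div_iff₀ h0, mul_comm]; exact h.2

lemma mem_densities_of_le (hv : 0 ≤ vMin) {ρ x : ℝ} (h : ρ ∈ densities vMin) (hx : 0 ≤ x)
    (hxρ : x ≤ ρ) : x ∈ densities vMin :=
  ⟨hx, (mul_le_mul_of_nonneg_right hxρ hv).trans_lt h.2⟩

lemma eventually_mem_densities {ρ : ℝ} (h : ρ ∈ densities vMin) (h0 : 0 < ρ) :
    ∀ᶠ x in 𝓝 ρ, x ∈ densities vMin ∧ 0 < x := by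
  have h1 : ∀ᶠ x in 𝓝 ρ, x * vMin < 1 :=
    (continuous_id.mul continuous_const).continuousAt.eventually_lt continuousAt_const h.2
  filter_upwards [h1, lt_mem_nhds h0] with x hx hx0 using ⟨⟨hx0.le, hx⟩, hx0⟩

lemma IsBetheWeyl.hasDerivAt_press (hB : IsBetheWeyl e vMin S) (hs : s ∈ S) {ρ : ℝ}
    (h : ρ ∈ densities vMin) (h0 : 0 < ρ) :
    HasDerivAt (press e s) (iteratedDeriv 2 (fun x => e x s) (1 / ρ) / ρ ^ 2) ρ := by
  have h1 : HasDerivAt (fun x : ℝ => 1 / x) (-(1 / ρ ^ 2)) ρ := by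
    simpa using hasDerivAt_inv h0.ne'
  have h2 := (hB.hasDerivAt_pressure hs (lt_one_div_of_mem h h0)).comp ρ h1
  refine h2.congr_deriv ?_
  ring

lemma soundSpeed_nonneg (e : ℝ → ℝ → ℝ) (s ρ : ℝ) : 0 ≤ soundSpeed e s ρ := by
  rw [soundSpeed]; split_ifs <;> simp

lemma soundSpeed_zero : soundSpeed e s 0 = 0 := by simp [soundSpeed]

lemma IsBetheWeyl.soundSpeed_eq (hB : IsBetheWeyl e vMin S) (hs : s ∈ S) {ρ : ℝ}
    (h : ρ ∈ densities vMin) (h0 : 0 < ρ) :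
    soundSpeed e s ρ = √(iteratedDeriv 2 (fun x => e x s) (1 / ρ)) / ρ := by
  rw [soundSpeed, if_pos h0, (hB.hasDerivAt_press hs h h0).deriv, Real.sqrt_div'  _ (by positivity),
    Real.sqrt_sq h0.le]

lemma IsBetheWeyl.soundSpeed_pos (hB : IsBetheWeyl e vMin S) (hs : s ∈ S) {ρ : ℝ}
    (h : ρ ∈ densities vMin) (h0 : 0 < ρ) : 0 < soundSpeed e s ρ := by
  rw [hB.soundSpeed_eq hs h h0]
  have := hB.iteratedDeriv_two_pos hs (lt_one_div_of_mem h h0)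
  positivity

lemma IsBetheWeyl.soundSpeed_sq (hB : IsBetheWeyl e vMin S) (hs : s ∈ S) {ρ : ℝ}
    (h : ρ ∈ densities vMin) (h0 : 0 < ρ) : soundSpeed e s ρ ^ 2 = deriv (press e s) ρ := by
  have := hB.iteratedDeriv_two_pos hs (lt_one_div_of_mem h h0)
  rw [soundSpeed, if_pos h0, Real.sq_sqrt]
  rw [(hB.hasDerivAt_press hs h h0).deriv]
  positivity

/-- The logarithmic derivative `ρ c'(ρ) / c(ρ)` is `𝒢 - 1`. -/
lemma IsBetheWeyl.hasDerivAt_soundSpeed (hB : IsBetheWeyl e vMin S) (hs : s ∈ S) {ρ : ℝ}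
    (h : ρ ∈ densities vMin) (h0 : 0 < ρ) :
    HasDerivAt (soundSpeed e s) ((scrG e (1 / ρ) s - 1) * (soundSpeed e s ρ / ρ)) ρ := by
  have hv := lt_one_div_of_mem h h0
  have hJ := hB.iteratedDeriv_two_pos hs hv
  have h1 : HasDerivAt (fun x : ℝ => 1 / x) (-(1 / ρ ^ 2)) ρ := by
    simpa using hasDerivAt_inv h0.ne'
  have h2 := (((hB.hasDerivAt_iteratedDeriv_two hs hv).comp ρ h1).sqrt hJ.ne').div
    (hasDerivAt_id ρ) h0.ne'
  refine (h2.congr_of_eventuallyEq ?_).congr_deriv ?_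
  · filter_upwards [eventually_mem_densities h h0] with x hx
    exact hB.soundSpeed_eq hs hx.1 hx.2
  · rw [hB.soundSpeed_eq hs h h0, scrG]
    simp only [Function.comp, id]
    have hq := Real.sq_sqrt hJ.le
    have hq0 := Real.sqrt_pos.2 hJ
    set q := √(iteratedDeriv 2 (fun x => e x s) (1 / ρ))
    rw [← hq]
    field_simp

lemma IsBetheWeyl.continuousAt_soundSpeed_div (hB : IsBetheWeyl e vMin S) (hs : s ∈ S) {ρ : ℝ}
    (h : ρ ∈ densities vMin) (h0 : 0 < ρ) : ContinuousAt (fun x => soundSpeed e s x / x) ρ :=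
  (hB.hasDerivAt_soundSpeed hs h h0).continuousAt.div continuousAt_id h0.ne'

lemma intervalIntegrable_soundSpeed_div (hB : IsBetheWeyl e vMin S) (hs : s ∈ S)
    (hG : IsAdmissibleGas e vMin s) {ρ : ℝ} (h : ρ ∈ densities vMin) :
    IntervalIntegrable (fun x => soundSpeed e s x / x) volume 0 ρ := by
  rw [intervalIntegrable_iff_integrableOn_Ioc_of_le h.1]
  obtain ⟨t, ht, hint⟩ := hG.integrable_zero
  obtain ⟨δ, hδ, hδt⟩ := mem_nhdsGT_iff_exists_Ioc_subset.1 ht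
  have h1 : IntegrableOn (fun x => soundSpeed e s x / x) (Ioc 0 δ) := hint.mono_set hδt
  have h2 : IntegrableOn (fun x => soundSpeed e s x / x) (Icc δ ρ) := by
    refine ContinuousOn.integrableOn_Icc fun x hx => ?_
    exact (hB.continuousAt_soundSpeed_div hs
      (mem_densities_of_le hB.vMin_nonneg h ((mem_Ioi.1 hδ).le.trans hx.1) hx.2)
      ((mem_Ioi.1 hδ).trans_le hx.1)).continuousWithinAt
  refine (h1.union h2).mono_set fun x hx => ?_
  rcases le_total x δ with hx' | hx'
  · exact Or.inl ⟨hx.1, hx'⟩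
  · exact Or.inr ⟨hx', hx.2⟩

lemma primH_zero : primH e s 0 = 0 := by simp [primH]

lemma primH_nonneg (e : ℝ → ℝ → ℝ) (s : ℝ) {ρ : ℝ} (h : 0 ≤ ρ) : 0 ≤ primH e s ρ :=
  intervalIntegral.integral_nonneg h fun x hx => div_nonneg (soundSpeed_nonneg e s x) hx.1

lemma hasStrictDerivAt_primH (hB : IsBetheWeyl e vMin S) (hs : s ∈ S)
    (hG : IsAdmissibleGas e vMin s) {ρ : ℝ} (h : ρ ∈ densities vMin) (h0 : 0 < ρ) :
    HasStrictDerivAt (primH e s) (soundSpeed e s ρ / ρ) ρ := by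
  refine intervalIntegral.integral_hasStrictDerivAt_right
    (intervalIntegrable_soundSpeed_div hB hs hG h) ?_ (hB.continuousAt_soundSpeed_div hs h h0)
  obtain ⟨V, hV, hVo, hρ⟩ := mem_nhds_iff.1 (eventually_mem_densities h h0)
  exact ContinuousOn.stronglyMeasurableAtFilter hVo (fun x hx =>
    (hB.continuousAt_soundSpeed_div hs (hV hx).1 (hV hx).2).continuousWithinAt) ρ hρ

lemma continuousOn_primH (hB : IsBetheWeyl e vMin S) (hs : s ∈ S)
    (hG : IsAdmissibleGas e vMin s) {ρ : ℝ} (h : ρ ∈ densities vMin) :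
    ContinuousOn (primH e s) (Icc 0 ρ) := by
  have := intervalIntegral.continuousOn_primitive_interval'
    (intervalIntegrable_soundSpeed_div hB hs hG h) left_mem_uIcc
  rwa [uIcc_of_le h.1] at this

lemma primH_strictMonoOn (hB : IsBetheWeyl e vMin S) (hs : s ∈ S)
    (hG : IsAdmissibleGas e vMin s) : StrictMonoOn (primH e s) (densities vMin) := by
  intro x hx y hy hxy
  refine strictMonoOn_of_deriv_pos (convex_Icc 0 y) (continuousOn_primH hB hs hG hy)
    (fun z hz => ?_) ⟨hx.1, hxy.le⟩ ⟨hy.1, le_rfl⟩ hxy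
  rw [interior_Icc] at hz
  have hz' := mem_densities_of_le hB.vMin_nonneg hy hz.1.le hz.2.le
  rw [(hasStrictDerivAt_primH hB hs hG hz' hz.1).hasDerivAt.deriv]
  exact div_pos (hB.soundSpeed_pos hs hz' hz.1) hz.1

lemma soundSpeed_monotoneOn (hB : IsBetheWeyl e vMin S) (hs : s ∈ S)
    (hG : IsAdmissibleGas e vMin s) : MonotoneOn (soundSpeed e s) (densities vMin) := by
  intro x hx y hy hxy
  rcases hx.1.eq_or_lt with h0 | h0
  · rw [← h0, soundSpeed_zero]; exact soundSpeed_nonneg e s y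
  have hd : ∀ z ∈ Icc x y, z ∈ densities vMin ∧ 0 < z := fun z hz =>
    ⟨mem_densities_of_le hB.vMin_nonneg hy (hx.1.trans hz.1) hz.2, h0.trans_le hz.1⟩
  refine monotoneOn_of_deriv_nonneg (convex_Icc x y)
    (fun z hz =>
      (hB.hasDerivAt_soundSpeed hs (hd z hz).1 (hd z hz).2).continuousAt.continuousWithinAt)
    (fun z hz => (hB.hasDerivAt_soundSpeed hs (hd z (interior_subset hz)).1
      (hd z (interior_subset hz)).2).differentiableAt.differentiableWithinAt)
    (fun z hz => ?_) ⟨le_rfl, hxy⟩ ⟨hxy, le_rfl⟩ hxy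
  obtain ⟨h1, h2⟩ := hd z (interior_subset hz)
  rw [(hB.hasDerivAt_soundSpeed hs h1 h2).deriv]
  exact mul_nonneg (sub_nonneg.2 (hG.scrG_mem _ (lt_one_div_of_mem h1 h2)).1.le)
    (div_nonneg (soundSpeed_nonneg e s z) h2.le)

lemma primH_sub_soundSpeed_le (hB : IsBetheWeyl e vMin S) (hs : s ∈ S)
    (hG : IsAdmissibleGas e vMin s) {x y : ℝ} (hx : x ∈ densities vMin) (hy : y ∈ densities vMin)
    (h0 : 0 < x) (hxy : x ≤ y) :
    primH e s x - soundSpeed e s x ≤ primH e s y - soundSpeed e s y := by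
  have hd : ∀ z ∈ Icc x y, z ∈ densities vMin ∧ 0 < z := fun z hz =>
    ⟨mem_densities_of_le hB.vMin_nonneg hy (hx.1.trans hz.1) hz.2, h0.trans_le hz.1⟩
  have hder : ∀ z ∈ Icc x y, HasDerivAt (fun z => primH e s z - soundSpeed e s z)
      (soundSpeed e s z / z - (scrG e (1 / z) s - 1) * (soundSpeed e s z / z)) z := fun z hz =>
    (hasStrictDerivAt_primH hB hs hG (hd z hz).1 (hd z hz).2).hasDerivAt.sub
      (hB.hasDerivAt_soundSpeed hs (hd z hz).1 (hd z hz).2)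
  refine monotoneOn_of_deriv_nonneg (convex_Icc x y)
    (fun z hz => (hder z hz).continuousAt.continuousWithinAt)
    (fun z hz => (hder z (interior_subset hz)).differentiableAt.differentiableWithinAt)
    (fun z hz => ?_) ⟨le_rfl, hxy⟩ ⟨hxy, le_rfl⟩ hxy
  obtain ⟨h1, h2⟩ := hd z (interior_subset hz)
  rw [(hder z (interior_subset hz)).deriv]
  have h3 := (hG.scrG_mem _ (lt_one_div_of_mem h1 h2)).2
  have h4 := div_nonneg (soundSpeed_nonneg e s z) h2.le
  nlinarith

/-- The sound speed vanishes in the vacuum limit: it is increasing, and `ρ ↦ 1 / ρ` is not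
integrable at `0`. -/
lemma exists_soundSpeed_lt (hB : IsBetheWeyl e vMin S) (hs : s ∈ S)
    (hG : IsAdmissibleGas e vMin s) {ρ : ℝ} (h : ρ ∈ densities vMin) (h0 : 0 < ρ) {ε : ℝ}
    (hε : 0 < ε) : ∃ x ∈ Ioc 0 ρ, soundSpeed e s x < ε := by
  by_contra! hc
  have hint := intervalIntegrable_soundSpeed_div hB hs hG h
  have h1 : IntervalIntegrable (fun x : ℝ => x⁻¹) volume 0 ρ := by
    refine (hint.const_mul ε⁻¹).mono_fun (by fun_prop) ?_
    rw [uIoc_of_le h.1]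
    refine (ae_restrict_iff' measurableSet_Ioc).2 (Eventually.of_forall fun x hx => ?_)
    have hx0 : 0 < x := hx.1
    have h2 := hc x hx
    have h3 := soundSpeed_nonneg e s x
    beta_reduce
    rw [Real.norm_of_nonneg (by positivity), Real.norm_of_nonneg (by positivity), ← div_eq_inv_mul,
      div_div, inv_eq_one_div, div_le_div_iff₀ hx0 (by positivity)]
    nlinarith
  rw [intervalIntegrable_inv_iff] at h1
  rcases h1 with h1 | h1
  · exact h0.ne h1
  · exact h1 left_mem_uIcc

lemma soundSpeed_le_primH (hB : IsBetheWeyl e vMin S) (hs : s ∈ S)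
    (hG : IsAdmissibleGas e vMin s) {ρ : ℝ} (h : ρ ∈ densities vMin) :
    soundSpeed e s ρ ≤ primH e s ρ := by
  rcases h.1.eq_or_lt with h0 | h0
  · rw [← h0, soundSpeed_zero, primH_zero]
  refine le_of_forall_pos_lt_add fun ε hε => ?_
  obtain ⟨x, hx, hxε⟩ := exists_soundSpeed_lt hB hs hG h h0 hε
  have := primH_sub_soundSpeed_le hB hs hG
    (mem_densities_of_le hB.vMin_nonneg h hx.1.le hx.2) h hx.1 hx.2
  have := primH_nonneg e s hx.1.le
  linarith

/-- As a function of `H`, the sound speed is `1`-Lipschitz, for `dc/dH = 𝒢 - 1 < 1`. -/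
lemma abs_soundSpeed_sub_le (hB : IsBetheWeyl e vMin S) (hs : s ∈ S)
    (hG : IsAdmissibleGas e vMin s) {x y : ℝ} (hx : x ∈ densities vMin) (hy : y ∈ densities vMin) :
    |soundSpeed e s x - soundSpeed e s y| ≤ |primH e s x - primH e s y| := by
  wlog hxy : x ≤ y generalizing x y
  · rw [abs_sub_comm, abs_sub_comm (primH e s x)]
    exact this hy hx (le_of_not_ge hxy)
  have hc := soundSpeed_monotoneOn hB hs hG hx hy hxy
  have hH := (primH_strictMonoOn hB hs hG).monotoneOn hx hy hxy
  rw [abs_of_nonpos (by linarith), abs_of_nonpos (by linarith)]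
  rcases hx.1.eq_or_lt with h0 | h0
  · rw [← h0, soundSpeed_zero, primH_zero]
    linarith [soundSpeed_le_primH hB hs hG hy]
  · linarith [primH_sub_soundSpeed_le hB hs hG hx hy h0 hxy]

/-! ### The shock conditions -/

/-- The jump of velocity is at least the jump of `H`; with `P = p₋ - p₊` and `V = v₊ - v₋`, this is
the Cauchy–Schwarz inequality for `∫ c · dρ/ρ`. It is obtained here from
`c / ρ ≤ (k c² + 1 / (k ρ²)) / 2` with the optimal constant `k = √(V / P)`. -/
lemma primH_sub_le_sqrt (hB : IsBetheWeyl e vMin S) (hs : s ∈ S)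
    (hG : IsAdmissibleGas e vMin s) {x y : ℝ} (hy : y ∈ densities vMin) (h0 : 0 < x) (hxy : x < y) :
    primH e s y - primH e s x ≤ √((press e s x - press e s y) * (1 / y - 1 / x)) := by
  have hd : ∀ z ∈ Icc x y, z ∈ densities vMin ∧ 0 < z := fun z hz =>
    ⟨mem_densities_of_le hB.vMin_nonneg hy (h0.le.trans hz.1) hz.2, h0.trans_le hz.1⟩
  have hp : press e s x < press e s y := by
    refine strictMonoOn_of_deriv_pos (convex_Icc x y) (fun z hz =>
      (hB.hasDerivAt_press hs (hd z hz).1 (hd z hz).2).continuousAt.continuousWithinAt)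
      (fun z hz => ?_) ⟨le_rfl, hxy.le⟩ ⟨hxy.le, le_rfl⟩ hxy
    obtain ⟨h1, h2⟩ := hd z (interior_subset hz)
    rw [(hB.hasDerivAt_press hs h1 h2).deriv]
    have := hB.iteratedDeriv_two_pos hs (lt_one_div_of_mem h1 h2)
    positivity
  have hv : 1 / y < 1 / x := one_div_lt_one_div_of_lt h0 hxy
  obtain ⟨A, hA⟩ : ∃ A, A = √(press e s y - press e s x) := ⟨_, rfl⟩
  obtain ⟨B, hBv⟩ : ∃ B, B = √(1 / x - 1 / y) := ⟨_, rfl⟩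
  have hA0 : 0 < A := by rw [hA]; exact Real.sqrt_pos.2 (by linarith)
  have hB0 : 0 < B := by rw [hBv]; exact Real.sqrt_pos.2 (by linarith)
  have hA2 : A ^ 2 = press e s y - press e s x := by rw [hA]; exact Real.sq_sqrt (by linarith)
  have hB2 : B ^ 2 = 1 / x - 1 / y := by rw [hBv]; exact Real.sq_sqrt (by linarith)
  have hR : (press e s x - press e s y) * (1 / y - 1 / x) = (A * B) ^ 2 := by
    rw [mul_pow, hA2, hB2]; ring
  rw [hR, Real.sqrt_sq (by positivity)]
  have hder : ∀ z ∈ Icc x y, HasDerivAt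
      (fun z => (B / A * press e s z - A / B * (1 / z)) / 2 - primH e s z)
      ((B / A * (soundSpeed e s z) ^ 2 - A / B * (-(1 / z ^ 2))) / 2 - soundSpeed e s z / z) z := by
    intro z hz
    obtain ⟨h1, h2⟩ := hd z hz
    have h3 : HasDerivAt (fun x : ℝ => 1 / x) (-(1 / z ^ 2)) z := by
      simpa using hasDerivAt_inv h2.ne'
    have h4 := (hB.hasDerivAt_press hs h1 h2).differentiableAt.hasDerivAt
    rw [← hB.soundSpeed_sq hs h1 h2] at h4
    exact (((h4.const_mul _).sub (h3.const_mul _)).div_const 2).sub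
      (hasStrictDerivAt_primH hB hs hG h1 h2).hasDerivAt
  have hmono := monotoneOn_of_deriv_nonneg (convex_Icc x y)
    (fun z hz => (hder z hz).continuousAt.continuousWithinAt)
    (fun z hz => (hder z (interior_subset hz)).differentiableAt.differentiableWithinAt)
    (fun z hz => ?_) ⟨le_rfl, hxy.le⟩ ⟨hxy.le, le_rfl⟩ hxy.le
  · have h5 : B / A * (press e s y - press e s x) = A * B := by rw [← hA2]; field_simp
    have h6 : A / B * (1 / x - 1 / y) = A * B := by rw [← hB2]; field_simp
    simp only at hmono
    linarith
  · rw [(hder z (interior_subset hz)).deriv]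
    have hz0 := (hd z (interior_subset hz)).2
    have : (B / A * (soundSpeed e s z) ^ 2 - A / B * (-(1 / z ^ 2))) / 2 - soundSpeed e s z / z
        = (B * soundSpeed e s z - A / z) ^ 2 / (2 * A * B) := by
      field_simp
      ring
    rw [this]
    positivity

/-- Lax's inequalities `u₊ + c₊ < U < u₋ + c₋` for a compressive jump. -/
lemma lax_inequalities (hB : IsBetheWeyl e vMin S) (hs : s ∈ S) {x y U um up : ℝ}
    (hy : y ∈ densities vMin) (h0 : 0 < x) (hxy : x < y)
    (hU : U * (x - y) = x * up - y * um)
    (hj : um - up = √((press e s x - press e s y) * (1 / y - 1 / x))) :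
    up + soundSpeed e s x < U ∧ U < um + soundSpeed e s y := by
  have hx := mem_densities_of_le hB.vMin_nonneg hy h0.le hxy.le
  have hy0 := h0.trans hxy
  have hv : 1 / y < 1 / x := one_div_lt_one_div_of_lt h0 hxy
  have hvm : vMin < 1 / y := lt_one_div_of_mem hy hy0
  obtain ⟨ξ, hξ, hξe⟩ := exists_hasDerivAt_eq_slope (fun v => pressure e v s)
    (fun v => -iteratedDeriv 2 (fun x => e x s) v) hv
    (fun v hv => (hB.hasDerivAt_pressure hs (hvm.trans_le hv.1)).continuousAt.continuousWithinAt)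
    (fun v hv => hB.hasDerivAt_pressure hs (hvm.trans hv.1))
  have hJ0 := hB.iteratedDeriv_two_pos hs (hvm.trans hξ.1)
  have hJx := hB.strictAntiOn_iteratedDeriv_two hs (hvm.trans hξ.1) (hvm.trans hv) hξ.2
  have hJy := hB.strictAntiOn_iteratedDeriv_two hs hvm (hvm.trans hξ.1) hξ.1
  rw [hB.soundSpeed_eq hs hx h0, hB.soundSpeed_eq hs hy hy0]
  have hqx := Real.sqrt_lt_sqrt (hB.iteratedDeriv_two_pos hs (hvm.trans hv)).le hJx
  have hqy := Real.sqrt_lt_sqrt hJ0.le hJy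
  have hq0 := Real.sqrt_pos.2 hJ0
  have hq2 := Real.sq_sqrt hJ0.le
  set q := √(iteratedDeriv 2 (fun x => e x s) ξ)
  have hP : press e s x - press e s y = - q ^ 2 * (1 / x - 1 / y) := by
    rw [hq2]
    rw [eq_div_iff (sub_pos.2 hv).ne'] at hξe
    exact hξe.symm
  -- the velocity jump is `q (v₊ - v₋)`, where `q²` is the slope of the chord of the isentrope
  have hjq : um - up = q * (1 / x - 1 / y) := by
    rw [hj, hP, show -q ^ 2 * (1 / x - 1 / y) * (1 / y - 1 / x) = (q * (1 / x - 1 / y)) ^ 2 by ring,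
      Real.sqrt_sq (mul_nonneg hq0.le (sub_pos.2 hv).le)]
  have hd : 1 / x - 1 / y = (y - x) / (x * y) := by field_simp
  have hyx : 0 < y - x := sub_pos.2 hxy
  have hU1 : U = up + q / x := by
    have h1 : (U - up) * (y - x) = y * (um - up) := by linarith
    rw [hjq, hd] at h1
    have h2 : y * (q * ((y - x) / (x * y))) = q / x * (y - x) := by field_simp
    rw [h2] at h1
    linarith [mul_right_cancel₀ hyx.ne' h1]
  have hU2 : U = um + q / y := by
    have h1 : (U - um) * (y - x) = x * (um - up) := by linarith
    rw [hjq, hd] at h1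
    have h2 : x * (q * ((y - x) / (x * y))) = q / y * (y - x) := by field_simp
    rw [h2] at h1
    linarith [mul_right_cancel₀ hyx.ne' h1]
  constructor
  · rw [hU1]; gcongr
  · rw [hU2]; gcongr

end Gas

/-! ### The transport equations of the Riemann invariants -/

section Transport

variable {e : ℝ → ℝ → ℝ} {vMin s : ℝ} {S : Set ℝ}

/-- `H` is strictly increasing, so that the density depends continuously on `H`. -/
lemma tendsto_density (hB : IsBetheWeyl e vMin S) (hs : s ∈ S) (hG : IsAdmissibleGas e vMin s)
    {α : Type*} {l : Filter α} {ρ : α → ℝ} {ρ₀ : ℝ} (hρ : ∀ᶠ x in l, ρ x ∈ densities vMin)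
    (h : ρ₀ ∈ densities vMin) (h0 : 0 < ρ₀)
    (hl : Tendsto (fun x => primH e s (ρ x)) l (𝓝 (primH e s ρ₀))) : Tendsto ρ l (𝓝 ρ₀) := by
  have hm := primH_strictMonoOn hB hs hG
  refine tendsto_order.2 ⟨fun y hy => ?_, fun y hy => ?_⟩
  · rcases lt_or_ge y 0 with hy0 | hy0
    · filter_upwards [hρ] with x hx using hy0.trans_le hx.1
    have hyd := mem_densities_of_le hB.vMin_nonneg h hy0 hy.le
    filter_upwards [hρ, hl.eventually_const_lt (hm hyd h hy)] with x hx hx'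
    exact (hm.lt_iff_lt hyd hx).1 hx'
  · by_cases hyd : y ∈ densities vMin
    · filter_upwards [hρ, hl.eventually_lt_const (hm h hyd hy)] with x hx hx'
      exact (hm.lt_iff_lt hx hyd).1 hx'
    · filter_upwards [hρ] with x hx
      by_contra! hc
      exact hyd (mem_densities_of_le hB.vMin_nonneg hx (h0.trans hy).le hc)

/-- The density inherits differentiability from `H` away from the vacuum. -/
lemma hasDerivAt_density (hB : IsBetheWeyl e vMin S) (hs : s ∈ S) (hG : IsAdmissibleGas e vMin s)
    {ρ : ℝ → ℝ} {x₀ h' : ℝ} (hρ : ∀ᶠ x in 𝓝 x₀, ρ x ∈ densities vMin) (h0 : 0 < ρ x₀)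
    (hh : HasDerivAt (fun x => primH e s (ρ x)) h' x₀) :
    HasDerivAt ρ (h' * (ρ x₀ / soundSpeed e s (ρ x₀))) x₀ := by
  have h := hρ.self_of_nhds
  have hst := hasStrictDerivAt_primH hB hs hG h h0
  have hne : soundSpeed e s (ρ x₀) / ρ x₀ ≠ 0 := (div_pos (hB.soundSpeed_pos hs h h0) h0).ne'
  have hc := tendsto_density hB hs hG hρ h h0 hh.continuousAt
  have h1 := (hst.to_localInverse hne).hasDerivAt.comp x₀ hh
  refine (h1.congr_of_eventuallyEq ?_).congr_deriv ?_
  · filter_upwards [hc.eventually (hst.eventually_left_inverse hne)] with x hx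
    exact hx.symm
  · rw [inv_div, mul_comm]

variable {d : ℕ} {F : Flow} {D : Set (ℝ × ℝ)}

lemma IsRegularSolution.density_mem (hF : IsRegularSolution e vMin s d F D) {z : ℝ × ℝ}
    (hz : z ∈ D) : F.ρ z.1 z.2 ∈ densities vMin :=
  ⟨hF.density_nonneg z hz, hF.density_lt_max z hz⟩

lemma Flow.u_eq (F : Flow) (e : ℝ → ℝ → ℝ) (s t r : ℝ) :
    F.u t r = (F.w₁ e s t r + F.w₂ e s t r) / 2 := by
  rw [Flow.w₁, Flow.w₂]; ring

lemma Flow.primH_eq (F : Flow) (e : ℝ → ℝ → ℝ) (s t r : ℝ) :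
    primH e s (F.ρ t r) = (F.w₂ e s t r - F.w₁ e s t r) / 2 := by
  rw [Flow.w₁, Flow.w₂]; ring

lemma IsRegularSolution.continuousOn_u (hF : IsRegularSolution e vMin s d F D) :
    ContinuousOn (fun z : ℝ × ℝ => F.u z.1 z.2) D := by
  simp_rw [fun z : ℝ × ℝ => F.u_eq e s z.1 z.2]
  exact (hF.contDiffOn_w₁.continuousOn.add hF.contDiffOn_w₂.continuousOn).div_const 2

lemma IsRegularSolution.continuousOn_primH (hF : IsRegularSolution e vMin s d F D) :
    ContinuousOn (fun z : ℝ × ℝ => primH e s (F.ρ z.1 z.2)) D := by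
  simp_rw [fun z : ℝ × ℝ => F.primH_eq e s z.1 z.2]
  exact (hF.contDiffOn_w₂.continuousOn.sub hF.contDiffOn_w₁.continuousOn).div_const 2

lemma IsRegularSolution.continuousOn_soundSpeed (hF : IsRegularSolution e vMin s d F D)
    (hB : IsBetheWeyl e vMin S) (hs : s ∈ S) (hG : IsAdmissibleGas e vMin s) :
    ContinuousOn (fun z : ℝ × ℝ => soundSpeed e s (F.ρ z.1 z.2)) D := by
  intro z hz
  have h := hF.continuousOn_primH z hz
  rw [ContinuousWithinAt, tendsto_iff_dist_tendsto_zero] at h ⊢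
  refine squeeze_zero' (Eventually.of_forall fun _ => dist_nonneg) ?_ h
  filter_upwards [self_mem_nhdsWithin] with y hy
  exact abs_soundSpeed_sub_le hB hs hG (hF.density_mem hy) (hF.density_mem hz)

/-- Inside the domain the system is equivalent to two transport equations with opposite source
terms. In the vacuum `w₂ - w₁ = 2 H` is minimal, so that both invariants have the differential
of `u`. -/
lemma IsRegularSolution.transport_interior (hF : IsRegularSolution e vMin s d F D)
    (hB : IsBetheWeyl e vMin S) (hs : s ∈ S) (hG : IsAdmissibleGas e vMin s) {t r : ℝ}
    (hz : (t, r) ∈ interior D) :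
    fderiv ℝ (fun z : ℝ × ℝ => F.w₁ e s z.1 z.2) (t, r) (1, F.speed₁ e s t r)
        = ((d : ℝ) - 1) * (soundSpeed e s (F.ρ t r) * F.u t r) / r ∧
      fderiv ℝ (fun z : ℝ × ℝ => F.w₂ e s z.1 z.2) (t, r) (1, F.speed₂ e s t r)
        = -(((d : ℝ) - 1) * (soundSpeed e s (F.ρ t r) * F.u t r) / r) := by
  have hD : D ∈ 𝓝 (t, r) := mem_interior_iff_mem_nhds.1 hz
  have h1 := ((hF.contDiffOn_w₁.contDiffAt hD).differentiableAt one_ne_zero).hasFDerivAt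
  have h2 := ((hF.contDiffOn_w₂.contDiffAt hD).differentiableAt one_ne_zero).hasFDerivAt
  set A := fderiv ℝ (fun z : ℝ × ℝ => F.w₁ e s z.1 z.2) (t, r)
  set B := fderiv ℝ (fun z : ℝ × ℝ => F.w₂ e s z.1 z.2) (t, r)
  have hsplit : ∀ (L : ℝ × ℝ →L[ℝ] ℝ) (y : ℝ), L (1, y) = L (1, 0) + y * L (0, 1) := by
    intro L y
    rw [show ((1 : ℝ), y) = (1, 0) + y • ((0 : ℝ), (1 : ℝ)) by simp, map_add, map_smul, smul_eq_mul]
  have hct : HasDerivAt (fun τ : ℝ => (τ, r)) ((1 : ℝ), (0 : ℝ)) t :=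
    (hasDerivAt_id t).prodMk (hasDerivAt_const t r)
  have hcr : HasDerivAt (fun x : ℝ => (t, x)) ((0 : ℝ), (1 : ℝ)) r :=
    (hasDerivAt_const r t).prodMk (hasDerivAt_id r)
  have h1t : HasDerivAt (fun τ => F.w₁ e s τ r) (A (1, 0)) t := by
    have := h1.comp_hasDerivAt t hct
    exact this
  have h1r : HasDerivAt (fun x => F.w₁ e s t x) (A (0, 1)) r := h1.comp_hasDerivAt r hcr
  have h2t : HasDerivAt (fun τ => F.w₂ e s τ r) (B (1, 0)) t := by
    have := h2.comp_hasDerivAt t hct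
    exact this
  have h2r : HasDerivAt (fun x => F.w₂ e s t x) (B (0, 1)) r := h2.comp_hasDerivAt r hcr
  rw [hsplit A, hsplit B, Flow.speed₁, Flow.speed₂]
  set at' := A (1, 0)
  set ar := A (0, 1)
  set bt := B (1, 0)
  set br := B (0, 1)
  have hut : HasDerivAt (fun τ => F.u τ r) ((at' + bt) / 2) t := by
    simp_rw [fun τ => F.u_eq e s τ r]
    exact (h1t.add h2t).div_const 2
  have hur : HasDerivAt (fun x => F.u t x) ((ar + br) / 2) r := by
    simp_rw [fun x => F.u_eq e s t x]
    exact (h1r.add h2r).div_const 2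
  have hHt : HasDerivAt (fun τ => primH e s (F.ρ τ r)) ((bt - at') / 2) t := by
    simp_rw [fun τ => F.primH_eq e s τ r]
    exact (h2t.sub h1t).div_const 2
  have hHr : HasDerivAt (fun x => primH e s (F.ρ t x)) ((br - ar) / 2) r := by
    simp_rw [fun x => F.primH_eq e s t x]
    exact (h2r.sub h1r).div_const 2
  have hmt : ∀ᶠ τ in 𝓝 t, (τ, r) ∈ D := hct.continuousAt.eventually hD
  have hmr : ∀ᶠ x in 𝓝 r, (t, x) ∈ D := hcr.continuousAt.eventually hD
  have hzD := interior_subset hz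
  rcases (hF.density_nonneg _ hzD).eq_or_lt with h0 | h0
  · have h0' : F.ρ t r = 0 := h0.symm
    have hm := hF.momentum_vacuum t r hz h0'
    rw [hut.deriv, hur.deriv] at hm
    have e1 : (bt - at') / 2 = 0 := by
      refine IsLocalMin.hasDerivAt_eq_zero ?_ hHt
      filter_upwards [hmt] with τ hτ
      rw [h0', primH_zero]
      exact primH_nonneg e s (hF.density_nonneg _ hτ)
    have e2 : (br - ar) / 2 = 0 := by
      refine IsLocalMin.hasDerivAt_eq_zero ?_ hHr
      filter_upwards [hmr] with x hx
      rw [h0', primH_zero]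
      exact primH_nonneg e s (hF.density_nonneg _ hx)
    have e1' : bt = at' := by linarith
    have e2' : br = ar := by linarith
    rw [e1', e2'] at hm ⊢
    rw [h0', soundSpeed_zero, zero_mul, mul_zero, zero_div]
    constructor <;> linarith
  · have h0' : 0 < F.ρ t r := h0
    have hmem : F.ρ t r ∈ densities vMin := hF.density_mem hzD
    have hc0 := hB.soundSpeed_pos hs hmem h0'
    have hρt := hasDerivAt_density hB hs hG (hmt.mono fun τ hτ => hF.density_mem hτ) h0' hHt
    have hρr := hasDerivAt_density hB hs hG (hmr.mono fun x hx => hF.density_mem hx) h0' hHr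
    have hmass := hF.mass t r hz h0'
    have hmom := hF.momentum t r hz h0'
    have hprod : HasDerivAt (fun x => F.ρ t x * F.u t x) _ r := hρr.mul hur
    rw [hρt.deriv, hprod.deriv] at hmass
    rw [hut.deriv, hur.deriv, hρr.deriv, ← hB.soundSpeed_sq hs hmem h0'] at hmom
    set c := soundSpeed e s (F.ρ t r)
    set R := F.ρ t r
    set u := F.u t r
    have e1 : (at' + bt) / 2 + u * ((ar + br) / 2) + c * ((br - ar) / 2) = 0 := by
      rw [← hmom]; field_simp
    have e2 : (bt - at') / 2 + u * ((br - ar) / 2) + c * ((ar + br) / 2)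
        = -(((d : ℝ) - 1) * (c * u) / r) := by
      have h3 := congrArg (fun y => c / R * y) hmass
      beta_reduce at h3
      have h4 : c / R * (-(((d : ℝ) - 1) * R * u) / r) = -(((d : ℝ) - 1) * (c * u) / r) := by
        field_simp
      rw [h4] at h3
      rw [← h3]
      field_simp
      ring
    constructor <;> linarith

/-- A function that is `C¹` up to the boundary has a differential that extends continuously the one
of the interior. The set need not be one of unique differentiability. -/
lemma exists_continuous_fderivWithin {f : ℝ × ℝ → ℝ} (hf : ContDiffOn ℝ 1 f D) {z : ℝ × ℝ}
    (hz : z ∈ D) : ∃ f' : ℝ × ℝ → ℝ × ℝ →L[ℝ] ℝ, ContinuousWithinAt f' D z ∧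
      HasFDerivWithinAt f (f' z) D z ∧ ∀ᶠ y in 𝓝[interior D] z, f' y = fderiv ℝ f y := by
  have h := hf z hz
  rw [show (1 : WithTop ℕ∞) = 0 + 1 by simp, contDiffWithinAt_succ_iff_hasFDerivWithinAt' (by simp),
    insert_eq_of_mem hz] at h
  obtain ⟨u, hu, -, -, f', hf', hc⟩ := h
  refine ⟨f', hc.continuousWithinAt, hf' z (mem_of_mem_nhdsWithin hz hu), ?_⟩
  filter_upwards [nhdsWithin_mono z interior_subset hu, self_mem_nhdsWithin] with y hy hyi
  exact ((hf' y hy).hasFDerivAt (mem_interior_iff_mem_nhds.1 hyi)).fderiv.symm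

/-- The transport equation of `w₁` up to the boundary. -/
lemma IsRegularSolution.transport_w₁ (hF : IsRegularSolution e vMin s d F D)
    (hB : IsBetheWeyl e vMin S) (hs : s ∈ S) (hG : IsAdmissibleGas e vMin s) {z : ℝ × ℝ}
    (hz : z ∈ D) (hcl : z ∈ closure (interior D)) (hr : z.2 ≠ 0) :
    ∃ A : ℝ × ℝ →L[ℝ] ℝ, HasFDerivWithinAt (fun z : ℝ × ℝ => F.w₁ e s z.1 z.2) A D z ∧
      A (1, F.speed₁ e s z.1 z.2)
        = ((d : ℝ) - 1) * (soundSpeed e s (F.ρ z.1 z.2) * F.u z.1 z.2) / z.2 := by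
  obtain ⟨f', hc, hf', heq⟩ := exists_continuous_fderivWithin hF.contDiffOn_w₁ hz
  refine ⟨f' z, hf', ?_⟩
  have : (𝓝[interior D] z).NeBot := mem_closure_iff_nhdsWithin_neBot.1 hcl
  have hu := hF.continuousOn_u z hz
  have hs' := hF.continuousOn_soundSpeed hB hs hG z hz
  have hL : Tendsto (fun y : ℝ × ℝ => f' y (1, F.speed₁ e s y.1 y.2)) (𝓝[interior D] z)
      (𝓝 (f' z (1, F.speed₁ e s z.1 z.2))) :=
    (hc.clm_apply (continuousWithinAt_const.prodMk (hu.sub hs'))).mono interior_subset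
  have hR : Tendsto (fun y : ℝ × ℝ => ((d : ℝ) - 1) *
      (soundSpeed e s (F.ρ y.1 y.2) * F.u y.1 y.2) / y.2) (𝓝[interior D] z)
      (𝓝 (((d : ℝ) - 1) * (soundSpeed e s (F.ρ z.1 z.2) * F.u z.1 z.2) / z.2)) :=
    ((continuousWithinAt_const.mul (hs'.mul hu)).div continuousWithinAt_snd hr).mono
      interior_subset
  refine tendsto_nhds_unique (hL.congr' ?_) hR
  filter_upwards [heq, self_mem_nhdsWithin] with y hy hyi
  rw [hy]
  exact (hF.transport_interior hB hs hG hyi).1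

/-- The transport equation of `w₂` up to the boundary. -/
lemma IsRegularSolution.transport_w₂ (hF : IsRegularSolution e vMin s d F D)
    (hB : IsBetheWeyl e vMin S) (hs : s ∈ S) (hG : IsAdmissibleGas e vMin s) {z : ℝ × ℝ}
    (hz : z ∈ D) (hcl : z ∈ closure (interior D)) (hr : z.2 ≠ 0) :
    ∃ A : ℝ × ℝ →L[ℝ] ℝ, HasFDerivWithinAt (fun z : ℝ × ℝ => F.w₂ e s z.1 z.2) A D z ∧
      A (1, F.speed₂ e s z.1 z.2)
        = -(((d : ℝ) - 1) * (soundSpeed e s (F.ρ z.1 z.2) * F.u z.1 z.2) / z.2) := by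
  obtain ⟨f', hc, hf', heq⟩ := exists_continuous_fderivWithin hF.contDiffOn_w₂ hz
  refine ⟨f' z, hf', ?_⟩
  have : (𝓝[interior D] z).NeBot := mem_closure_iff_nhdsWithin_neBot.1 hcl
  have hu := hF.continuousOn_u z hz
  have hs' := hF.continuousOn_soundSpeed hB hs hG z hz
  have hL : Tendsto (fun y : ℝ × ℝ => f' y (1, F.speed₂ e s y.1 y.2)) (𝓝[interior D] z)
      (𝓝 (f' z (1, F.speed₂ e s z.1 z.2))) :=
    (hc.clm_apply (continuousWithinAt_const.prodMk (hu.add hs'))).mono interior_subset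
  have hR : Tendsto (fun y : ℝ × ℝ => -(((d : ℝ) - 1) *
      (soundSpeed e s (F.ρ y.1 y.2) * F.u y.1 y.2) / y.2)) (𝓝[interior D] z)
      (𝓝 (-(((d : ℝ) - 1) * (soundSpeed e s (F.ρ z.1 z.2) * F.u z.1 z.2) / z.2))) :=
    ((continuousWithinAt_const.mul (hs'.mul hu)).div continuousWithinAt_snd hr).neg.mono
      interior_subset
  refine tendsto_nhds_unique (hL.congr' ?_) hR
  filter_upwards [heq, self_mem_nhdsWithin] with y hy hyi
  rw [hy]
  exact (hF.transport_interior hB hs hG hyi).2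

/-- On a compact set the differential of a function that is `C¹` up to the boundary is bounded. -/
lemma exists_norm_fderiv_le {f : ℝ × ℝ → ℝ} (hf : ContDiffOn ℝ 1 f D) {K : Set (ℝ × ℝ)}
    (hK : IsCompact K) (hKD : K ⊆ D) :
    ∃ B : ℝ, ∀ y ∈ K ∩ interior D, ‖fderiv ℝ f y‖ ≤ B := by
  refine hK.induction_on (p := fun K => ∃ B : ℝ, ∀ y ∈ K ∩ interior D, ‖fderiv ℝ f y‖ ≤ B)
    ⟨0, by simp⟩ (fun K₁ K₂ h ⟨B, hB⟩ => ⟨B, fun y hy => hB y ⟨h hy.1, hy.2⟩⟩) ?_ ?_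
  · rintro K₁ K₂ ⟨B₁, h₁⟩ ⟨B₂, h₂⟩
    refine ⟨max B₁ B₂, ?_⟩
    rintro y ⟨hy | hy, hyi⟩
    · exact (h₁ y ⟨hy, hyi⟩).trans (le_max_left _ _)
    · exact (h₂ y ⟨hy, hyi⟩).trans (le_max_right _ _)
  · intro z hz
    obtain ⟨f', hc, -, heq⟩ := exists_continuous_fderivWithin hf (hKD hz)
    have h1 : ∀ᶠ y in 𝓝[interior D] z, ‖f' y‖ < ‖f' z‖ + 1 :=
      (hc.norm.mono interior_subset).eventually_lt_const (by simp)
    obtain ⟨V, hV, hV'⟩ := mem_nhdsWithin_iff_exists_mem_nhds_inter.1 (h1.and heq)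
    refine ⟨V, mem_nhdsWithin_of_mem_nhds hV, ‖f' z‖ + 1, fun y hy => ?_⟩
    obtain ⟨h2, h3⟩ := hV' hy
    rw [← h3]
    exact h2.le

/-- The inequality `c ≤ H`; it amounts to `w₁ ≤ u - c`, and to `u + c ≤ w₂`. -/
lemma IsRegularSolution.soundSpeed_le (hF : IsRegularSolution e vMin s d F D)
    (hB : IsBetheWeyl e vMin S) (hs : s ∈ S) (hG : IsAdmissibleGas e vMin s) {z : ℝ × ℝ}
    (hz : z ∈ D) :
    soundSpeed e s (F.ρ z.1 z.2) ≤ (F.w₂ e s z.1 z.2 - F.w₁ e s z.1 z.2) / 2 := by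
  rw [← F.primH_eq]
  exact soundSpeed_le_primH hB hs hG (hF.density_mem hz)

end Transport

/-! ### Barriers, monotonicity and integral curves -/

section Tools

/-- Barrier principle: `f` stays above the decreasing function `A - κ t` on a compact set of points
`(t, r)` if, at every point where it does not obviously do so, some direction `(1, v)` points
backward in time into the set and `f` decreases less than the barrier in that direction. It is
proved at a contact point of smallest time. -/
lemma lower_barrier {K : Set (ℝ × ℝ)} (hK : IsCompact K) {f : ℝ × ℝ → ℝ} (hf : ContinuousOn f K)
    {A κ : ℝ}
    (h : ∀ z ∈ K, A - κ * z.1 < f z ∨ ∃ (v : ℝ) (L : ℝ × ℝ →L[ℝ] ℝ), HasFDerivWithinAt f L K z ∧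
      (∀ᶠ ε in 𝓝[>] (0 : ℝ), (z.1 - ε, z.2 - ε * v) ∈ K) ∧
      (f z = A - κ * z.1 → -κ < L (1, v))) :
    ∀ z ∈ K, A - κ * z.1 < f z := by
  by_contra! hc
  have hbad : IsCompact {z ∈ K | f z ≤ A - κ * z.1} := by
    have hcont : ContinuousOn (fun z => f z - (A - κ * z.1)) K := by fun_prop
    have := hcont.preimage_isClosed_of_isClosed hK.isClosed (isClosed_Iic (a := (0 : ℝ)))
    refine hK.of_isClosed_subset ?_ (fun z hz => hz.1)
    convert this using 1
    ext z
    simp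
  obtain ⟨z₀, hz₀, hz₀'⟩ := hc
  obtain ⟨z, ⟨hz, hzf⟩, hmin⟩ := hbad.exists_isMinOn ⟨z₀, hz₀, hz₀'⟩ continuous_fst.continuousOn
  rcases h z hz with h1 | ⟨v, L, hL, hin, hlt⟩
  · exact absurd hzf (not_le.2 h1)
  have hgood : ∀ᶠ ε in 𝓝[>] (0 : ℝ), A - κ * z.1 + κ * ε < f (z.1 - ε, z.2 - ε * v) := by
    filter_upwards [hin, self_mem_nhdsWithin] with ε hε hε0
    by_contra! hcon
    have := hmin (show (z.1 - ε, z.2 - ε * v) ∈ {z ∈ K | f z ≤ A - κ * z.1} from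
      ⟨hε, by linarith⟩)
    simp only [mem_ofPred_eq] at this
    linarith [mem_Ioi.1 hε0]
  have hpath : ContinuousWithinAt (fun ε : ℝ => (z.1 - ε, z.2 - ε * v)) (Ioi 0) 0 := by
    fun_prop
  have hto : Tendsto (fun ε : ℝ => (z.1 - ε, z.2 - ε * v)) (𝓝[>] 0) (𝓝[K] z) := by
    refine tendsto_nhdsWithin_iff.2 ⟨?_, hin⟩
    simpa [ContinuousWithinAt] using hpath
  have hfz : f z = A - κ * z.1 := by
    refine le_antisymm hzf (le_of_tendsto_of_tendsto ?_ ((hf z hz).tendsto.comp hto)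
      (hgood.mono fun ε hε => hε.le))
    have : ContinuousWithinAt (fun ε : ℝ => A - κ * z.1 + κ * ε) (Ioi 0) 0 := by fun_prop
    simpa [ContinuousWithinAt] using this
  have hder : HasDerivWithinAt (fun ε : ℝ => f (z.1 - ε, z.2 - ε * v)) (L (-1, -v))
      ({ε | (z.1 - ε, z.2 - ε * v) ∈ K} ∩ Ioi 0) 0 := by
    have h1 : HasDerivWithinAt (fun ε : ℝ => (z.1 - ε, z.2 - ε * v)) (-1, -v)
        ({ε | (z.1 - ε, z.2 - ε * v) ∈ K} ∩ Ioi 0) 0 := by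
      have := ((hasDerivWithinAt_id (0 : ℝ) ({ε | (z.1 - ε, z.2 - ε * v) ∈ K} ∩ Ioi 0)).const_sub
        z.1).prodMk (((hasDerivWithinAt_id (0 : ℝ)
          ({ε | (z.1 - ε, z.2 - ε * v) ∈ K} ∩ Ioi 0)).mul_const v).const_sub z.2)
      simpa using this
    have h2 : HasFDerivWithinAt f L K ((fun ε : ℝ => (z.1 - ε, z.2 - ε * v)) 0) := by
      simpa using hL
    exact h2.comp_hasDerivWithinAt 0 h1 (fun ε hε => hε.1)
  rw [hasDerivWithinAt_iff_tendsto_slope' (by simp), inter_comm,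
    nhdsWithin_inter_of_mem' hin] at hder
  have hκ : κ ≤ L (-1, -v) := by
    refine ge_of_tendsto hder ?_
    filter_upwards [hgood, self_mem_nhdsWithin] with ε hε hε0
    have hε0' : 0 < ε := hε0
    simp only [slope_def_field, sub_zero, zero_mul, Prod.mk.eta]
    rw [le_div_iff₀ hε0', hfz]
    linarith
  have hneg : L (-1, -v) = - L (1, v) := by rw [← map_neg]; simp
  linarith [hlt hfz]

/-- If the derivatives of two functions are nonnegative wherever both functions are positive, then
positive initial values are lower bounds. -/
lemma le_of_deriv_nonneg_of_pos {g₁ g₂ : ℝ → ℝ} {a b : ℝ} (hab : a ≤ b)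
    (hc₁ : ContinuousOn g₁ (Icc a b)) (hc₂ : ContinuousOn g₂ (Icc a b)) (h₁ : 0 < g₁ a)
    (h₂ : 0 < g₂ a)
    (hd : ∀ x ∈ Ioo a b, 0 < g₁ x → 0 < g₂ x →
      (∃ y, 0 ≤ y ∧ HasDerivAt g₁ y x) ∧ ∃ y, 0 ≤ y ∧ HasDerivAt g₂ y x) :
    g₁ a ≤ g₁ b ∧ g₂ a ≤ g₂ b := by
  have hsub : Icc a b ⊆ {x | g₁ a ≤ g₁ x ∧ g₂ a ≤ g₂ x} := by
    refine IsClosed.Icc_subset_of_forall_mem_nhdsWithin ?_ ⟨le_rfl, le_rfl⟩ ?_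
    · have e1 := hc₁.preimage_isClosed_of_isClosed isClosed_Icc (isClosed_Ici (a := g₁ a))
      have e2 := hc₂.preimage_isClosed_of_isClosed isClosed_Icc (isClosed_Ici (a := g₂ a))
      convert e1.inter e2 using 1
      ext x
      simp only [mem_inter_iff, mem_ofPred_eq, mem_preimage, mem_Ici]
      tauto
    · rintro x ⟨⟨hx₁, hx₂⟩, hx⟩
      have hpos : ∀ᶠ y in 𝓝[Icc a b] x, 0 < g₁ y ∧ 0 < g₂ y :=
        ((hc₁ x ⟨hx.1, hx.2.le⟩).eventually_const_lt (h₁.trans_le hx₁)).and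
          ((hc₂ x ⟨hx.1, hx.2.le⟩).eventually_const_lt (h₂.trans_le hx₂))
      have hpos' : ∀ᶠ y in 𝓝[≥] x, (0 < g₁ y ∧ 0 < g₂ y) ∧ y < b := by
        have hI : Icc a b ∈ 𝓝[≥] x :=
          mem_of_superset (Icc_mem_nhdsGE hx.2) (Icc_subset_Icc_left hx.1)
        exact (hpos.filter_mono (nhdsWithin_le_of_mem hI)).and
          (eventually_nhdsWithin_of_eventually_nhds (gt_mem_nhds hx.2))
      obtain ⟨c, hxc, hc⟩ := (mem_nhdsGE_iff_exists_Icc_subset).1 hpos'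
      filter_upwards [Ioc_mem_nhdsGT hxc] with y hy
      have hI : Icc x y ⊆ Icc a b := fun z hz =>
        ⟨hx.1.trans hz.1, ((hc ⟨hz.1, hz.2.trans hy.2⟩).2).le⟩
      have hder : ∀ z ∈ interior (Icc x y), (∃ y, 0 ≤ y ∧ HasDerivAt g₁ y z) ∧
          ∃ y, 0 ≤ y ∧ HasDerivAt g₂ y z := fun z hz => by
        rw [interior_Icc] at hz
        obtain ⟨⟨p1, p2⟩, p3⟩ := hc ⟨hz.1.le, hz.2.le.trans hy.2⟩
        exact hd z ⟨hx.1.trans_lt hz.1, p3⟩ p1 p2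
      constructor
      · refine hx₁.trans (monotoneOn_of_deriv_nonneg (convex_Icc x y) (hc₁.mono hI)
          (fun z hz => ?_) (fun z hz => ?_) ⟨le_rfl, hy.1.le⟩ ⟨hy.1.le, le_rfl⟩ hy.1.le)
        · obtain ⟨⟨w, -, hw⟩, -⟩ := hder z hz
          exact hw.differentiableAt.differentiableWithinAt
        · obtain ⟨⟨w, hw0, hw⟩, -⟩ := hder z hz
          rwa [hw.deriv]
      · refine hx₂.trans (monotoneOn_of_deriv_nonneg (convex_Icc x y) (hc₂.mono hI)
          (fun z hz => ?_) (fun z hz => ?_) ⟨le_rfl, hy.1.le⟩ ⟨hy.1.le, le_rfl⟩ hy.1.le)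
        · obtain ⟨-, ⟨w, -, hw⟩⟩ := hder z hz
          exact hw.differentiableAt.differentiableWithinAt
        · obtain ⟨-, ⟨w, hw0, hw⟩⟩ := hder z hz
          rwa [hw.deriv]
  exact hsub ⟨hab, le_rfl⟩

/-- A bounded, globally Lipschitz field has an integral curve on all of `[0, t]` that ends at a
given point. -/
lemma exists_integralCurve {f : ℝ → ℝ → ℝ} {t : ℝ} (ht : 0 ≤ t) (r : ℝ) {K B : NNReal}
    (hlip : ∀ τ ∈ Icc 0 t, LipschitzWith K (f τ)) (hcont : ∀ x, ContinuousOn (f · x) (Icc 0 t))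
    (hb : ∀ τ ∈ Icc 0 t, ∀ x, |f τ x| ≤ B) :
    ∃ X : ℝ → ℝ, X t = r ∧ ∀ τ ∈ Icc 0 t, HasDerivWithinAt X (f τ (X τ)) (Icc 0 t) τ := by
  have hpl : IsPicardLindelof f (⟨t, ht, le_rfl⟩ : Icc 0 t) r (B * ⟨t, ht⟩) 0 B K := by
    refine ⟨fun τ hτ => (hlip τ hτ).lipschitzOnWith, fun x _ => hcont x,
      fun τ hτ x _ => hb τ hτ x, ?_⟩
    simp only [sub_self, sub_zero, max_eq_right ht, NNReal.coe_zero]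
    exact le_rfl
  exact hpl.exists_eq_forall_mem_Icc_hasDerivWithinAt₀

lemma hasDerivWithinAt_along {f : ℝ × ℝ → ℝ} {D : Set (ℝ × ℝ)} {I : Set ℝ} {X : ℝ → ℝ} {τ v : ℝ}
    {A : ℝ × ℝ →L[ℝ] ℝ} (hf : HasFDerivWithinAt f A D (τ, X τ)) (hX : HasDerivWithinAt X v I τ)
    (hD : ∀ σ ∈ I, (σ, X σ) ∈ D) :
    HasDerivWithinAt (fun σ => f (σ, X σ)) (A (1, v)) I τ := by
  have h1 : HasDerivWithinAt (fun σ => (σ, X σ)) ((1 : ℝ), v) I τ :=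
    (hasDerivWithinAt_id τ I).prodMk hX
  have := HasFDerivWithinAt.comp_hasDerivWithinAt (f := fun σ => (σ, X σ)) τ hf h1 hD
  exact this

end Tools

/-! ### Geometry of the domains -/

section Geometry

/-- The points `(τ, r)` with `0 ≤ τ ≤ t` and `f τ ≤ r ≤ g τ`. -/
def strip (t : ℝ) (f g : ℝ → ℝ) : Set (ℝ × ℝ) := {z | z.1 ∈ Icc 0 t ∧ z.2 ∈ Icc (f z.1) (g z.1)}

lemma isCompact_strip {t : ℝ} {f g : ℝ → ℝ} (hf : ContinuousOn f (Icc 0 t))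
    (hg : ContinuousOn g (Icc 0 t)) : IsCompact (strip t f g) := by
  obtain ⟨A, hA⟩ := (isCompact_Icc.image_of_continuousOn hf).bddBelow
  obtain ⟨B, hB⟩ := (isCompact_Icc.image_of_continuousOn hg).bddAbove
  refine ((isCompact_Icc (a := (0 : ℝ)) (b := t)).prod
    (isCompact_Icc (a := A) (b := B))).of_isClosed_subset ?_ ?_
  · have hI : IsClosed (Icc 0 t ×ˢ (univ : Set ℝ)) := isClosed_Icc.prod isClosed_univ
    have hm : MapsTo Prod.fst (Icc 0 t ×ˢ (univ : Set ℝ)) (Icc 0 t) := fun z hz => hz.1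
    have h1 : ContinuousOn (fun z : ℝ × ℝ => z.2 - f z.1) (Icc 0 t ×ˢ (univ : Set ℝ)) :=
      continuousOn_snd.sub (hf.comp continuousOn_fst hm)
    have h2 : ContinuousOn (fun z : ℝ × ℝ => g z.1 - z.2) (Icc 0 t ×ˢ (univ : Set ℝ)) :=
      (hg.comp continuousOn_fst hm).sub continuousOn_snd
    convert (h1.preimage_isClosed_of_isClosed hI (isClosed_Ici (a := (0 : ℝ)))).inter
      (h2.preimage_isClosed_of_isClosed hI (isClosed_Ici (a := (0 : ℝ)))) using 1
    ext z
    simp only [strip, mem_ofPred_eq, mem_inter_iff, mem_prod, mem_univ, and_true, mem_preimage,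
      mem_Ici, sub_nonneg, mem_Icc]
    tauto
  · rintro z ⟨h1, h2⟩
    exact ⟨h1, (hA (mem_image_of_mem f h1)).trans h2.1, h2.2.trans (hB (mem_image_of_mem g h1))⟩

lemma eventually_pos_of_deriv {q : ℝ → ℝ} {q' : ℝ} (hq : HasDerivAt q q' 0) (h0 : 0 ≤ q 0)
    (h : q 0 = 0 → 0 < q') : ∀ᶠ ε in 𝓝[>] (0 : ℝ), 0 < q ε := by
  rcases h0.eq_or_lt with h1 | h1
  · have hs := ((hasDerivWithinAt_iff_tendsto_slope' (by simp)).1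
      (hq.hasDerivWithinAt (s := Ioi 0))).eventually_const_lt (h h1.symm)
    filter_upwards [hs, self_mem_nhdsWithin] with ε hε hε0
    have hε0' : 0 < ε := hε0
    rw [slope_def_field, ← h1, sub_zero, sub_zero] at hε
    exact (div_pos_iff_of_pos_right hε0').1 hε
  · exact (hq.continuousAt.eventually_const_lt h1).filter_mono nhdsWithin_le_nhds

variable {e : ℝ → ℝ → ℝ} {vMin s : ℝ} {S : Set ℝ} {d : ℕ} {R₀ T : ℝ} {x₁ x₂ U : ℝ → ℝ} {L P : Flow}

lemma IsShockFlow.continuousOn₁ (h : IsShockFlow e vMin s d R₀ T x₁ x₂ U L P) :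
    ContinuousOn x₁ (Ico 0 T) := fun t ht => (h.characteristic t ht).continuousWithinAt

lemma IsShockFlow.continuousOn₂ (h : IsShockFlow e vMin s d R₀ T x₁ x₂ U L P) :
    ContinuousOn x₂ (Ico 0 T) := fun t ht => (h.shock_curve t ht).continuousWithinAt

lemma IsShockFlow.le (h : IsShockFlow e vMin s d R₀ T x₁ x₂ U L P) {t : ℝ} (ht : t ∈ Ico 0 T) :
    x₁ t ≤ x₂ t := by
  rcases ht.1.eq_or_lt with h0 | h0
  · rw [← h0, h.start₁, h.start₂]
  · exact (h.lt t ⟨h0, ht.2⟩).le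

lemma IsShockFlow.hasDerivAt₁ (h : IsShockFlow e vMin s d R₀ T x₁ x₂ U L P) {t : ℝ}
    (ht : t ∈ Ioo 0 T) : HasDerivAt x₁ (L.speed₁ e s t (x₁ t)) t :=
  (h.characteristic t ⟨ht.1.le, ht.2⟩).hasDerivAt (Ico_mem_nhds ht.1 ht.2)

lemma IsShockFlow.hasDerivAt₂ (h : IsShockFlow e vMin s d R₀ T x₁ x₂ U L P) {t : ℝ}
    (ht : t ∈ Ioo 0 T) : HasDerivAt x₂ (U t) t :=
  (h.shock_curve t ⟨ht.1.le, ht.2⟩).hasDerivAt (Ico_mem_nhds ht.1 ht.2)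

lemma IsShockFlow.mem_interior_domZero (h : IsShockFlow e vMin s d R₀ T x₁ x₂ U L P) {t r : ℝ}
    (ht : t ∈ Ioo 0 T) (hr : r ∈ Ioo (x₁ t) (x₂ t)) : (t, r) ∈ interior (domZero T x₁ x₂) := by
  rw [mem_interior_iff_mem_nhds]
  have h1 : ContinuousAt (fun z : ℝ × ℝ => x₁ z.1) (t, r) :=
    ContinuousAt.comp (f := Prod.fst) (h.hasDerivAt₁ ht).continuousAt continuousAt_fst
  have h2 : ContinuousAt (fun z : ℝ × ℝ => x₂ z.1) (t, r) :=
    ContinuousAt.comp (f := Prod.fst) (h.hasDerivAt₂ ht).continuousAt continuousAt_fst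
  filter_upwards [h1.eventually_lt continuousAt_snd hr.1, continuousAt_snd.eventually_lt h2 hr.2,
    continuousAt_fst.eventually (Ioo_mem_nhds ht.1 ht.2)] with z z1 z2 z3
  exact ⟨⟨z3.1.le, z3.2⟩, z1.le, z2.le⟩

lemma IsShockFlow.mem_closure_domZero (h : IsShockFlow e vMin s d R₀ T x₁ x₂ U L P) {t r : ℝ}
    (ht : t ∈ Ioo 0 T) (hr : r ∈ Icc (x₁ t) (x₂ t)) :
    (t, r) ∈ closure (interior (domZero T x₁ x₂)) := by
  rw [← closure_Ioo (h.lt t ht).ne] at hr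
  exact map_mem_closure (f := fun x : ℝ => (t, x)) (by fun_prop) hr
    fun x hx => h.mem_interior_domZero ht hx

lemma IsShockFlow.mem_interior_domPlus (h : IsShockFlow e vMin s d R₀ T x₁ x₂ U L P) {t r : ℝ}
    (ht : t ∈ Ioo 0 T) (hr : x₂ t < r) : (t, r) ∈ interior (domPlus T x₂) := by
  rw [mem_interior_iff_mem_nhds]
  have h2 : ContinuousAt (fun z : ℝ × ℝ => x₂ z.1) (t, r) :=
    ContinuousAt.comp (f := Prod.fst) (h.hasDerivAt₂ ht).continuousAt continuousAt_fst
  filter_upwards [h2.eventually_lt continuousAt_snd hr,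
    continuousAt_fst.eventually (Ioo_mem_nhds ht.1 ht.2)] with z z1 z3
  exact ⟨⟨z3.1.le, z3.2⟩, z1.le⟩

lemma IsShockFlow.mem_closure_domPlus (h : IsShockFlow e vMin s d R₀ T x₁ x₂ U L P) {t r : ℝ}
    (ht : t ∈ Ioo 0 T) (hr : x₂ t ≤ r) : (t, r) ∈ closure (interior (domPlus T x₂)) := by
  rw [← mem_Ici, ← closure_Ioi] at hr
  exact map_mem_closure (f := fun x : ℝ => (t, x)) (by fun_prop) hr
    fun x hx => h.mem_interior_domPlus ht hx

lemma strip_subset_domZero {t : ℝ} (ht : t < T) : strip t x₁ x₂ ⊆ domZero T x₁ x₂ :=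
  fun _ hz => ⟨⟨hz.1.1, hz.1.2.trans_lt ht⟩, hz.2⟩

lemma IsShockFlow.isCompact_strip (h : IsShockFlow e vMin s d R₀ T x₁ x₂ U L P) {t : ℝ}
    (ht : t < T) : IsCompact (strip t x₁ x₂) :=
  RadialShock.isCompact_strip (h.continuousOn₁.mono (Icc_subset_Ico_right ht))
    (h.continuousOn₂.mono (Icc_subset_Ico_right ht))

/-- A direction faster than the shock points backward into `D₀`. -/
lemma IsShockFlow.eventually_mem_strip (h : IsShockFlow e vMin s d R₀ T x₁ x₂ U L P) {t v : ℝ}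
    {z : ℝ × ℝ} (ht : t < T) (hz : z ∈ strip t x₁ x₂) (h1 : x₁ z.1 < z.2)
    (h2 : z.2 = x₂ z.1 → U z.1 < v) :
    ∀ᶠ ε in 𝓝[>] (0 : ℝ), (z.1 - ε, z.2 - ε * v) ∈ strip t x₁ x₂ := by
  have hz0 : 0 < z.1 := by
    refine hz.1.1.lt_of_ne fun h0 => ?_
    have := h1.trans_le hz.2.2
    rw [← h0, h.start₁, h.start₂] at this
    exact lt_irrefl _ this
  have hzT : z.1 ∈ Ioo 0 T := ⟨hz0, hz.1.2.trans_lt ht⟩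
  have e0 : HasDerivAt (fun ε : ℝ => z.1 - ε) (-1) 0 := (hasDerivAt_id (0 : ℝ)).const_sub z.1
  have e1 : HasDerivAt (fun ε : ℝ => z.2 - ε * v) (-v) 0 := by
    simpa using ((hasDerivAt_id (0 : ℝ)).mul_const v).const_sub z.2
  have e2 := HasDerivAt.comp_of_eq (0 : ℝ) (h.hasDerivAt₂ hzT) e0 (by simp)
  have e3 := HasDerivAt.comp_of_eq (0 : ℝ) (h.hasDerivAt₁ hzT) e0 (by simp)
  have q0 := eventually_pos_of_deriv e0 (by simpa using hz0.le) (by simp [hz0.ne'])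
  have q2 := eventually_pos_of_deriv (e2.sub e1) (by simpa using hz.2.2) (fun h0 => by
    have := h2 (by simp at h0; linarith)
    linarith)
  have q3 := eventually_pos_of_deriv (e1.sub e3) (by simpa using h1.le) (fun h0 => by
    simp at h0; linarith)
  filter_upwards [q0, q2, q3, self_mem_nhdsWithin] with ε h0 h2 h3 hε
  simp only [Pi.sub_apply, Function.comp_apply, sub_pos] at h0 h2 h3
  exact ⟨⟨by simp only; linarith, by simp only; linarith [mem_Ioi.1 hε, hz.1.2]⟩, h3.le, h2.le⟩

/-- A direction slower than the shock and faster than `-B r` points backward into the part of `D₊`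
below the curve `r exp (2 B τ) = R`. -/
lemma IsShockFlow.eventually_mem_strip_plus (h : IsShockFlow e vMin s d R₀ T x₁ x₂ U L P)
    {t v B R : ℝ} {z : ℝ × ℝ} (ht : t < T)
    (hz : z ∈ strip t x₂ fun τ => R * Real.exp (-(2 * B * τ))) (hz0 : 0 < z.1)
    (hB : 0 < B) (hr : 0 < z.2) (h1 : -(B * z.2) ≤ v) (h2 : z.2 = x₂ z.1 → v < U z.1) :
    ∀ᶠ ε in 𝓝[>] (0 : ℝ),
      (z.1 - ε, z.2 - ε * v) ∈ strip t x₂ fun τ => R * Real.exp (-(2 * B * τ)) := by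
  have hzT : z.1 ∈ Ioo 0 T := ⟨hz0, hz.1.2.trans_lt ht⟩
  have e0 : HasDerivAt (fun ε : ℝ => z.1 - ε) (-1) 0 := (hasDerivAt_id (0 : ℝ)).const_sub z.1
  have e1 : HasDerivAt (fun ε : ℝ => z.2 - ε * v) (-v) 0 := by
    simpa using ((hasDerivAt_id (0 : ℝ)).mul_const v).const_sub z.2
  have e2 := HasDerivAt.comp_of_eq (0 : ℝ) (h.hasDerivAt₂ hzT) e0 (by simp)
  have e3 : HasDerivAt (fun ε : ℝ => R * Real.exp (-(2 * B * (z.1 - ε))))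
      (R * Real.exp (-(2 * B * z.1)) * (2 * B)) 0 := by
    have := (((e0.const_mul (2 * B)).neg).exp).const_mul R
    refine this.congr_deriv ?_
    simp
    ring
  have q0 := eventually_pos_of_deriv e0 (by simpa using hz0.le) (by simp [hz0.ne'])
  have q2 := eventually_pos_of_deriv (e1.sub e2) (by simpa using hz.2.1) (fun h0 => by
    have := h2 (by simp at h0; linarith)
    linarith)
  have q3 := eventually_pos_of_deriv (e3.sub e1) (by simpa using hz.2.2) (fun h0 => by
    simp only [Pi.sub_apply, sub_zero, zero_mul] at h0
    have h3 : R * Real.exp (-(2 * B * z.1)) = z.2 := by linarith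
    rw [h3]
    nlinarith [mul_pos hB hr])
  filter_upwards [q0, q2, q3, self_mem_nhdsWithin] with ε h0 h2 h3 hε
  simp only [Pi.sub_apply, Function.comp_apply, sub_pos] at h0 h2 h3
  exact ⟨⟨by simp only; linarith, by simp only; linarith [mem_Ioi.1 hε, hz.1.2]⟩, h2.le, h3.le⟩

end Geometry

/-! ### A priori bounds -/

section Bounds

variable {e : ℝ → ℝ → ℝ} {vMin s : ℝ} {S : Set ℝ} {d : ℕ} {R₀ T : ℝ} {x₁ x₂ U : ℝ → ℝ} {L P : Flow}

/-- If `w₂ ≤ K` then `c u ≤ K² / 4`: for `u ≥ 0` one has `c u ≤ H u = (w₂² - w₁²) / 4`. -/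
lemma source_le {c w₁ w₂ K : ℝ} (hc0 : 0 ≤ c) (hc : c ≤ (w₂ - w₁) / 2) (hw : w₂ ≤ K) :
    c * ((w₁ + w₂) / 2) ≤ K ^ 2 / 4 := by
  rcases le_total ((w₁ + w₂) / 2) 0 with hu | hu
  · exact (mul_nonpos_of_nonneg_of_nonpos hc0 hu).trans (by positivity)
  · have h1 := mul_le_mul_of_nonneg_right hc hu
    have h2 : w₂ ^ 2 ≤ K ^ 2 := pow_le_pow_left₀ (by linarith) hw 2
    nlinarith [sq_nonneg w₁]

lemma le_source {c w₁ w₂ K : ℝ} (hc0 : 0 ≤ c) (hc : c ≤ (w₂ - w₁) / 2) (hw : -K ≤ w₁) :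
    -(K ^ 2 / 4) ≤ c * ((w₁ + w₂) / 2) := by
  have := source_le (w₁ := -w₂) (w₂ := -w₁) (K := K) hc0 (by linarith) (by linarith)
  have h2 : c * ((-w₂ + -w₁) / 2) = -(c * ((w₁ + w₂) / 2)) := by ring
  linarith

lemma source_div_lt {k q r K : ℝ} (hk0 : 0 ≤ k) (hk : k ≤ 2) (hR : 0 < R₀) (hr : R₀ ≤ r)
    (hK : 0 < K) (hq : q ≤ K ^ 2 / 4) : k * q / r < K ^ 2 / R₀ := by
  have hr0 : 0 < r := hR.trans_le hr
  have hK2 : 0 < K ^ 2 := by positivity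
  have h1 : k * q ≤ K ^ 2 / 2 := by nlinarith [mul_le_mul_of_nonneg_left hq hk0]
  calc k * q / r ≤ K ^ 2 / 2 / r := by gcongr
    _ ≤ K ^ 2 / 2 / R₀ := by gcongr
    _ < K ^ 2 / R₀ := by gcongr; linarith

lemma continuousOn_graph {f : ℝ × ℝ → ℝ} {D : Set (ℝ × ℝ)} (hf : ContinuousOn f D) {I : Set ℝ}
    {X : ℝ → ℝ} (hX : ContinuousOn X I) (hD : ∀ τ ∈ I, (τ, X τ) ∈ D) :
    ContinuousOn (fun τ => f (τ, X τ)) I :=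
  hf.comp (continuousOn_id.prodMk hX) hD

lemma IsShockFlow.left_mem_domZero (h : IsShockFlow e vMin s d R₀ T x₁ x₂ U L P) {t : ℝ}
    (ht : t ∈ Ico 0 T) : (t, x₁ t) ∈ domZero T x₁ x₂ := ⟨ht, le_rfl, h.le ht⟩

lemma IsShockFlow.right_mem_domZero (h : IsShockFlow e vMin s d R₀ T x₁ x₂ U L P) {t : ℝ}
    (ht : t ∈ Ico 0 T) : (t, x₂ t) ∈ domZero T x₁ x₂ := ⟨ht, h.le ht, le_rfl⟩

lemma right_mem_domPlus {t : ℝ} (ht : t ∈ Ico 0 T) : (t, x₂ t) ∈ domPlus T x₂ :=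
  ⟨ht, mem_Ici.2 le_rfl⟩

lemma Flow.w₁_le_w₂ {F : Flow} {D : Set (ℝ × ℝ)} (hF : IsRegularSolution e vMin s d F D)
    {z : ℝ × ℝ} (hz : z ∈ D) : F.w₁ e s z.1 z.2 ≤ F.w₂ e s z.1 z.2 := by
  have h1 := F.primH_eq e s z.1 z.2
  have h2 := primH_nonneg e s (hF.density_nonneg z hz)
  linarith

/-- Along the curve `r = x₁`, as long as `w₁` and `r` are positive, `w₁` grows since its source is
nonnegative, and `r` grows since `λ₁ ≥ w₁`. -/
lemma IsShockFlow.monotone_left (h : IsShockFlow e vMin s d R₀ T x₁ x₂ U L P)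
    (hB : IsBetheWeyl e vMin S) (hs : s ∈ S) (hG : IsAdmissibleGas e vMin s) (hd : 1 ≤ d)
    {β t : ℝ} (hβ : 0 ≤ β) (hβt : β ≤ t) (ht : t < T) (hw : 0 < L.w₁ e s β (x₁ β))
    (hx : 0 < x₁ β) : L.w₁ e s β (x₁ β) ≤ L.w₁ e s t (x₁ t) ∧ x₁ β ≤ x₁ t := by
  have hI : Icc β t ⊆ Ico 0 T := fun τ hτ => ⟨hβ.trans hτ.1, hτ.2.trans_lt ht⟩
  have hx₁ := h.continuousOn₁.mono hI
  have hF := h.regular_zero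
  refine le_of_deriv_nonneg_of_pos (g₁ := fun τ => L.w₁ e s τ (x₁ τ)) hβt
    (continuousOn_graph hF.contDiffOn_w₁.continuousOn hx₁ fun τ hτ => h.left_mem_domZero (hI hτ))
    hx₁ hw hx fun τ hτ h1 h2 => ?_
  have hτT : τ ∈ Ioo 0 T := ⟨hβ.trans_lt hτ.1, hτ.2.trans ht⟩
  have hz := h.left_mem_domZero ⟨hτT.1.le, hτT.2⟩
  have hcl := h.mem_closure_domZero hτT ⟨le_rfl, (h.lt τ hτT).le⟩
  obtain ⟨A, hA, hAe⟩ := hF.transport_w₁ hB hs hG hz hcl h2.ne'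
  have hle := Flow.w₁_le_w₂ hF hz
  have hc0 := soundSpeed_nonneg e s (L.ρ τ (x₁ τ))
  have hc := hF.soundSpeed_le hB hs hG hz
  have hu := L.u_eq e s τ (x₁ τ)
  have hd' : (0 : ℝ) ≤ (d : ℝ) - 1 := by
    have : (1 : ℝ) ≤ d := by exact_mod_cast hd
    linarith
  simp only at hle hc hAe
  have hu0 : 0 ≤ L.u τ (x₁ τ) := by linarith
  refine ⟨⟨_, ?_, (hasDerivWithinAt_along hA (h.characteristic τ ⟨hτT.1.le, hτT.2⟩)
    (fun σ hσ => h.left_mem_domZero hσ)).hasDerivAt (Ico_mem_nhds hτT.1 hτT.2)⟩,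
    ⟨_, ?_, h.hasDerivAt₁ hτT⟩⟩
  · rw [hAe]; positivity
  · rw [Flow.speed₁]; linarith

/-- The one-sided bounds on the slopes of the Riemann invariants in `D₊` allow at most logarithmic,
hence at most linear, growth in `r`. -/
lemma IsShockFlow.exists_neg_mul_le (h : IsShockFlow e vMin s d R₀ T x₁ x₂ U L P) {C₀ t : ℝ}
    (hR : 0 < R₀) (hC : 0 < C₀) (ht : t ∈ Ico 0 T) (hx : ∀ τ ∈ Icc 0 t, R₀ ≤ x₂ τ)
    (hder : ∀ t ∈ Ico 0 T, ∀ r ∈ Ioi (x₂ t), -C₀ / r ≤ deriv (fun x => P.w₁ e s t x) r) :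
    ∃ B : ℝ, 0 < B ∧ ∀ τ ∈ Ioc 0 t, ∀ r, x₂ τ ≤ r → -(B * r) ≤ P.w₁ e s τ r := by
  have hI : Icc 0 t ⊆ Ico 0 T := fun τ hτ => ⟨hτ.1, hτ.2.trans_lt ht.2⟩
  have hF := h.regular_plus
  have hg : ContinuousOn (fun τ => P.w₁ e s τ (x₂ τ)) (Icc 0 t) :=
    continuousOn_graph hF.contDiffOn_w₁.continuousOn (h.continuousOn₂.mono hI)
      fun τ hτ => right_mem_domPlus (hI hτ)
  obtain ⟨A, hA⟩ := (isCompact_Icc.image_of_continuousOn hg).bddBelow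
  refine ⟨(|A| + C₀) / R₀, by positivity, fun τ hτ r hr => ?_⟩
  have hτT : τ ∈ Ioo 0 T := ⟨hτ.1, hτ.2.trans_lt ht.2⟩
  have hA' : A ≤ P.w₁ e s τ (x₂ τ) := hA (mem_image_of_mem _ ⟨hτ.1.le, hτ.2⟩)
  have hx0 := hx τ ⟨hτ.1.le, hτ.2⟩
  have hxp : 0 < x₂ τ := hR.trans_le hx0
  have hr0 : 0 < r := hxp.trans_le hr
  have hcont : ContinuousOn (fun x => P.w₁ e s τ x) (Icc (x₂ τ) r) :=
    hF.contDiffOn_w₁.continuousOn.comp (f := fun x : ℝ => (τ, x)) (by fun_prop)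
      fun x hx => ⟨⟨hτT.1.le, hτT.2⟩, hx.1⟩
  have hdiff : ∀ x ∈ Ioo (x₂ τ) r, HasDerivAt (fun x => P.w₁ e s τ x + C₀ * Real.log x)
      (deriv (fun x => P.w₁ e s τ x) x + C₀ * x⁻¹) x := by
    intro x hx
    have h1 := (hF.contDiffOn_w₁.contDiffAt (mem_interior_iff_mem_nhds.1
      (h.mem_interior_domPlus hτT hx.1))).differentiableAt one_ne_zero
    have h2 : DifferentiableAt ℝ (fun x => P.w₁ e s τ x) x :=
      DifferentiableAt.comp (f := fun x : ℝ => (τ, x)) x h1 (by fun_prop)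
    exact h2.hasDerivAt.add ((Real.hasDerivAt_log (hxp.trans hx.1).ne').const_mul C₀)
  have hmono := monotoneOn_of_deriv_nonneg (f := fun x => P.w₁ e s τ x + C₀ * Real.log x)
    (convex_Icc (x₂ τ) r)
    (hcont.add ((Real.continuousOn_log.mono fun x hx => (hxp.trans_le hx.1).ne').const_mul C₀))
    (fun x hx => (hdiff x (by rwa [interior_Icc] at hx)).differentiableAt.differentiableWithinAt)
    (fun x hx => by
      rw [interior_Icc] at hx
      rw [(hdiff x hx).deriv]
      have := hder τ ⟨hτT.1.le, hτT.2⟩ x hx.1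
      rw [neg_div, div_eq_mul_inv] at this
      linarith) ⟨le_rfl, hr⟩ ⟨hr, le_rfl⟩ hr
  have hlog : Real.log r - Real.log (x₂ τ) ≤ r / R₀ := by
    rw [← Real.log_div hr0.ne' hxp.ne']
    calc Real.log (r / x₂ τ) ≤ r / x₂ τ - 1 := Real.log_le_sub_one_of_pos (by positivity)
      _ ≤ r / x₂ τ := by linarith
      _ ≤ r / R₀ := by gcongr
  have h1 : |A| ≤ |A| * (r / R₀) :=
    le_mul_of_one_le_right (abs_nonneg A) ((one_le_div hR).2 (hx0.trans hr))
  have h2 := mul_le_mul_of_nonneg_left hlog hC.le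
  have h3 := neg_abs_le A
  have h4 : (|A| + C₀) / R₀ * r = |A| * (r / R₀) + C₀ * (r / R₀) := by ring
  simp only at hmono
  rw [h4]
  linarith

/-- Bounds in `D₊`, as long as Lax's condition holds on the shock. They are barrier arguments on the
regions `r ≤ R exp (-2 B τ)`, whose outer boundary is faster than the characteristics. The source of
each invariant is controlled by the lower bound of `w₁` alone. -/
lemma IsShockFlow.bounds_plus (h : IsShockFlow e vMin s d R₀ T x₁ x₂ U L P)
    (hB : IsBetheWeyl e vMin S) (hs : s ∈ S) (hG : IsAdmissibleGas e vMin s) (hd : d = 2 ∨ d = 3)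
    {C₀ t m M η K : ℝ} (hR : 0 < R₀) (hC : 0 < C₀) (ht : t ∈ Ico 0 T)
    (hx : ∀ τ ∈ Icc 0 t, R₀ ≤ x₂ τ)
    (hder : ∀ t ∈ Ico 0 T, ∀ r ∈ Ioi (x₂ t), -C₀ / r ≤ deriv (fun x => P.w₁ e s t x) r)
    (hm : ∀ r, R₀ ≤ r → m ≤ P.w₁ e s 0 r) (hM : ∀ r, R₀ ≤ r → P.w₂ e s 0 r ≤ M)
    (hlax : ∀ τ ∈ Icc 0 t, P.ρ τ (x₂ τ) < L.ρ τ (x₂ τ))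
    (hη : 0 < η) (hη1 : η + K ^ 2 / R₀ * t ≤ 1) (hK : 0 < K) (hmK : -K ≤ m - 1) :
    ∀ z ∈ domPlus T x₂, z.1 ≤ t → m - η - K ^ 2 / R₀ * z.1 < P.w₁ e s z.1 z.2 ∧
      P.w₂ e s z.1 z.2 < M + η + K ^ 2 / R₀ * z.1 := by
  intro z₀ hz₀ hz₀t
  have hF := h.regular_plus
  obtain ⟨B, hB0, hgrow⟩ := h.exists_neg_mul_le hR hC ht hx hder
  have hk0 : (0 : ℝ) ≤ (d : ℝ) - 1 := by rcases hd with rfl | rfl <;> norm_num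
  have hk2 : (d : ℝ) - 1 ≤ 2 := by rcases hd with rfl | rfl <;> norm_num
  have hI : Icc 0 t ⊆ Ico 0 T := fun τ hτ => ⟨hτ.1, hτ.2.trans_lt ht.2⟩
  -- the region below the curve through `z₀`
  obtain ⟨G, hGdef⟩ : ∃ G, G = strip t x₂ fun τ =>
    z₀.2 * Real.exp (2 * B * z₀.1) * Real.exp (-(2 * B * τ)) := ⟨_, rfl⟩
  have hGc : IsCompact G := by
    rw [hGdef]
    exact RadialShock.isCompact_strip (h.continuousOn₂.mono hI) (by fun_prop)
  have hGD : G ⊆ domPlus T x₂ := by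
    rw [hGdef]
    exact fun z hz => ⟨hI hz.1, hz.2.1⟩
  have hz₀G : z₀ ∈ G := by
    rw [hGdef]
    refine ⟨⟨hz₀.1.1, hz₀t⟩, hz₀.2, ?_⟩
    beta_reduce
    rw [mul_assoc, ← Real.exp_add]
    simp
  have hGt : ∀ z ∈ G, z.1 ∈ Icc 0 t ∧ x₂ z.1 ≤ z.2 := by
    rw [hGdef]
    exact fun z hz => ⟨hz.1, hz.2.1⟩
  have hGr : ∀ z ∈ G, R₀ ≤ z.2 := fun z hz => (hx _ (hGt z hz).1).trans (hGt z hz).2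
  have hwle : ∀ z ∈ G, P.w₁ e s z.1 z.2 ≤ P.w₂ e s z.1 z.2 := fun z hz =>
    Flow.w₁_le_w₂ hF (hGD hz)
  have hc0 : ∀ z : ℝ × ℝ, 0 ≤ soundSpeed e s (P.ρ z.1 z.2) := fun z => soundSpeed_nonneg e s _
  have hc : ∀ z ∈ G, soundSpeed e s (P.ρ z.1 z.2) ≤ (P.w₂ e s z.1 z.2 - P.w₁ e s z.1 z.2) / 2 :=
    fun z hz => hF.soundSpeed_le hB hs hG (hGD hz)
  have hlax' : ∀ z ∈ G, z.2 = x₂ z.1 → P.speed₂ e s z.1 z.2 < U z.1 := fun z hz hzx => by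
    have hzt := (hGt z hz).1
    have := lax_inequalities hB hs (hy := h.regular_zero.density_mem
      (h.right_mem_domZero (hI hzt))) (h.density_right_pos _ (hI hzt)) (hlax _ hzt)
      (h.jump_mass _ (hI hzt)) (h.jump_velocity _ (hI hzt))
    rw [hzx]
    exact this.1
  have hdir : ∀ z ∈ G, 0 < z.1 → ∀ v, P.w₁ e s z.1 z.2 ≤ v → v ≤ P.speed₂ e s z.1 z.2 →
      ∀ᶠ ε in 𝓝[>] (0 : ℝ), (z.1 - ε, z.2 - ε * v) ∈ G := by
    intro z hz hz0 v hv1 hv2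
    have h1 := hgrow z.1 ⟨hz0, (hGt z hz).1.2⟩ z.2 (hGt z hz).2
    have h2 := hlax' z hz
    have h3 := hR.trans_le (hGr z hz)
    rw [hGdef] at hz ⊢
    exact h.eventually_mem_strip_plus ht.2 hz hz0 hB0 h3 (h1.trans hv1)
      fun hzx => hv2.trans_lt (h2 hzx)
  have hcl : ∀ z ∈ G, 0 < z.1 → z ∈ closure (interior (domPlus T x₂)) := fun z hz hz0 =>
    h.mem_closure_domPlus ⟨hz0, (hI (hGt z hz).1).2⟩ (hGt z hz).2
  have hκt : ∀ z ∈ G, K ^ 2 / R₀ * z.1 ≤ K ^ 2 / R₀ * t := fun z hz =>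
    mul_le_mul_of_nonneg_left (hGt z hz).1.2 (by positivity)
  have hsrc : ∀ z ∈ G, -K ≤ P.w₁ e s z.1 z.2 →
      -(K ^ 2 / R₀) < ((d : ℝ) - 1) * (soundSpeed e s (P.ρ z.1 z.2) * P.u z.1 z.2) / z.2 := by
    intro z hz hzK
    have h1 := le_source (hc0 z) (hc z hz) hzK
    rw [← P.u_eq] at h1
    have h2 := source_div_lt (q := -(soundSpeed e s (P.ρ z.1 z.2) * P.u z.1 z.2)) hk0 hk2 hR
      (hGr z hz) hK (by linarith)
    rw [mul_neg, neg_div] at h2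
    linarith
  have hw₁ := lower_barrier hGc (hF.contDiffOn_w₁.continuousOn.mono hGD) (A := m - η)
    (κ := K ^ 2 / R₀) (fun z hz => by
      rcases (hGt z hz).1.1.eq_or_lt with hz0 | hz0
      · left
        have := hm z.2 (hGr z hz)
        rw [← hz0]
        linarith
      · right
        obtain ⟨A, hA, hAe⟩ := hF.transport_w₁ hB hs hG (hGD hz) (hcl z hz hz0)
          (hR.trans_le (hGr z hz)).ne'
        have h1 := hc z hz
        have h2 := hwle z hz
        have h3 := P.u_eq e s z.1 z.2
        refine ⟨P.speed₁ e s z.1 z.2, A, hA.mono hGD, hdir z hz hz0 _ ?_ ?_, fun hzeq => ?_⟩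
        · rw [Flow.speed₁]; linarith
        · rw [Flow.speed₁, Flow.speed₂]; linarith [hc0 z]
        · rw [hAe]
          refine hsrc z hz ?_
          have := hκt z hz
          rw [hzeq]
          linarith)
  have hw₂ := lower_barrier hGc (hF.contDiffOn_w₂.continuousOn.mono hGD).fun_neg (A := -(M + η))
    (κ := K ^ 2 / R₀) (fun z hz => by
      rcases (hGt z hz).1.1.eq_or_lt with hz0 | hz0
      · left
        have := hM z.2 (hGr z hz)
        rw [← hz0]
        linarith
      · right
        obtain ⟨A, hA, hAe⟩ := hF.transport_w₂ hB hs hG (hGD hz) (hcl z hz hz0)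
          (hR.trans_le (hGr z hz)).ne'
        have h1 := hc z hz
        have h2 := hwle z hz
        have h3 := P.u_eq e s z.1 z.2
        refine ⟨P.speed₂ e s z.1 z.2, -A, (hA.mono hGD).fun_neg, hdir z hz hz0 _ ?_ le_rfl,
          fun _ => ?_⟩
        · rw [Flow.speed₂]; linarith [hc0 z]
        · rw [neg_apply, hAe, neg_neg]
          refine hsrc z hz ?_
          have h5 := hκt z hz
          have h6 := hw₁ z hz
          linarith)
  have h1 := hw₁ z₀ hz₀G
  have h2 := hw₂ z₀ hz₀G
  exact ⟨h1, by linarith⟩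

/-- Bounds in `D₀`, as long as Lax's condition holds on the shock: `w₂` enters through the curve
`r = x₁`, where it is at least `w₁ ≥ a`, and `w₁` enters through the shock, across which it
increases. -/
lemma IsShockFlow.bounds_zero (h : IsShockFlow e vMin s d R₀ T x₁ x₂ U L P)
    (hB : IsBetheWeyl e vMin S) (hs : s ∈ S) (hG : IsAdmissibleGas e vMin s) (hd : d = 2 ∨ d = 3)
    {t a m η K : ℝ} (hR : 0 < R₀) (ht : t ∈ Ico 0 T)
    (ha : ∀ τ ∈ Icc 0 t, a ≤ L.w₁ e s τ (x₁ τ)) (hx : ∀ τ ∈ Icc 0 t, R₀ ≤ x₁ τ)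
    (hm : ∀ τ ∈ Icc 0 t, m - η - K ^ 2 / R₀ * τ < P.w₁ e s τ (x₂ τ))
    (hlax : ∀ τ ∈ Icc 0 t, P.ρ τ (x₂ τ) < L.ρ τ (x₂ τ))
    (hη : 0 < η) (hηt : K ^ 2 / R₀ * t ≤ η) (hηa : 5 * η ≤ a + m) (hma : m ≤ a) (hK : 0 < K)
    (haK : a ≤ K) :
    ∀ z ∈ strip t x₁ x₂, a - η - K ^ 2 / R₀ * z.1 < L.w₂ e s z.1 z.2 ∧
      m - 2 * η - K ^ 2 / R₀ * z.1 < L.w₁ e s z.1 z.2 := by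
  have hF := h.regular_zero
  have hk0 : (0 : ℝ) ≤ (d : ℝ) - 1 := by rcases hd with rfl | rfl <;> norm_num
  have hk2 : (d : ℝ) - 1 ≤ 2 := by rcases hd with rfl | rfl <;> norm_num
  have hI : Icc 0 t ⊆ Ico 0 T := fun τ hτ => ⟨hτ.1, hτ.2.trans_lt ht.2⟩
  have hGc := h.isCompact_strip ht.2
  have hGD : strip t x₁ x₂ ⊆ domZero T x₁ x₂ := strip_subset_domZero ht.2
  have hGr : ∀ z ∈ strip t x₁ x₂, R₀ ≤ z.2 := fun z hz => (hx _ hz.1).trans hz.2.1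
  have hwle : ∀ z ∈ strip t x₁ x₂, L.w₁ e s z.1 z.2 ≤ L.w₂ e s z.1 z.2 := fun z hz =>
    Flow.w₁_le_w₂ hF (hGD hz)
  have hc0 : ∀ z : ℝ × ℝ, 0 ≤ soundSpeed e s (L.ρ z.1 z.2) := fun z => soundSpeed_nonneg e s _
  have hc : ∀ z ∈ strip t x₁ x₂,
      soundSpeed e s (L.ρ z.1 z.2) ≤ (L.w₂ e s z.1 z.2 - L.w₁ e s z.1 z.2) / 2 :=
    fun z hz => hF.soundSpeed_le hB hs hG (hGD hz)
  have hpos : ∀ z ∈ strip t x₁ x₂, x₁ z.1 < z.2 → 0 < z.1 := fun z hz hz1 => by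
    refine hz.1.1.lt_of_ne fun h0 => ?_
    have := hz1.trans_le hz.2.2
    rw [← h0, h.start₁, h.start₂] at this
    exact lt_irrefl _ this
  have hκt : ∀ z ∈ strip t x₁ x₂, 0 ≤ K ^ 2 / R₀ * z.1 ∧ K ^ 2 / R₀ * z.1 ≤ η := fun z hz =>
    ⟨mul_nonneg (by positivity) hz.1.1,
      (mul_le_mul_of_nonneg_left hz.1.2 (by positivity)).trans hηt⟩
  have hw₂ := lower_barrier hGc (hF.contDiffOn_w₂.continuousOn.mono hGD) (A := a - η)
    (κ := K ^ 2 / R₀) (fun z hz => by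
      have h4 := hκt z hz
      have h2 := hwle z hz
      rcases hz.2.1.eq_or_lt with hz1 | hz1
      · left
        have := ha z.1 hz.1
        rw [hz1] at this
        linarith
      · right
        have hz0 := hpos z hz hz1
        obtain ⟨A, hA, hAe⟩ := hF.transport_w₂ hB hs hG (hGD hz)
          (h.mem_closure_domZero ⟨hz0, (hI hz.1).2⟩ hz.2) (hR.trans_le (hGr z hz)).ne'
        refine ⟨L.speed₂ e s z.1 z.2, A, hA.mono hGD,
          h.eventually_mem_strip ht.2 hz hz1 fun hzx => ?_, fun hzeq => ?_⟩
        · have := lax_inequalities hB hs (hy := hF.density_mem (h.right_mem_domZero (hI hz.1)))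
            (h.density_right_pos _ (hI hz.1)) (hlax _ hz.1) (h.jump_mass _ (hI hz.1))
            (h.jump_velocity _ (hI hz.1))
          rw [hzx]
          exact this.2
        · rw [hAe]
          have h1 := source_le (K := K) (hc0 z) (hc z hz) (by linarith)
          rw [← L.u_eq] at h1
          exact neg_lt_neg (source_div_lt hk0 hk2 hR (hGr z hz) hK h1))
  have hw₁ := lower_barrier hGc (hF.contDiffOn_w₁.continuousOn.mono hGD) (A := m - 2 * η)
    (κ := K ^ 2 / R₀) (fun z hz => by
      have h4 := hκt z hz
      rcases hz.2.1.eq_or_lt with hz1 | hz1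
      · left
        have := ha z.1 hz.1
        rw [hz1] at this
        linarith
      rcases hz.2.2.eq_or_lt with hz2 | hz2
      · left
        have h5 := hm z.1 hz.1
        have h6 := primH_sub_le_sqrt hB hs hG
          (hF.density_mem (h.right_mem_domZero (hI hz.1)))
          (h.density_right_pos _ (hI hz.1)) (hlax _ hz.1)
        rw [← h.jump_velocity _ (hI hz.1)] at h6
        simp only [Flow.w₁] at h5 ⊢
        rw [hz2]
        linarith
      · right
        have hz0 := hpos z hz hz1
        obtain ⟨A, hA, hAe⟩ := hF.transport_w₁ hB hs hG (hGD hz)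
          (h.mem_closure_domZero ⟨hz0, (hI hz.1).2⟩ hz.2) (hR.trans_le (hGr z hz)).ne'
        refine ⟨L.speed₁ e s z.1 z.2, A, hA.mono hGD,
          h.eventually_mem_strip ht.2 hz hz1 fun hzx => absurd hzx hz2.ne, fun hzeq => ?_⟩
        have h5 := hw₂ z hz
        have h6 := L.u_eq e s z.1 z.2
        have h7 : 0 ≤ L.u z.1 z.2 := by linarith
        have h8 : 0 < z.2 := hR.trans_le (hGr z hz)
        have h9 := hc0 z
        rw [hAe]
        refine (neg_neg_of_pos (by positivity)).trans_le (by positivity))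
  exact fun z hz => ⟨hw₂ z hz, hw₁ z hz⟩

end Bounds

/-! ### Persistence of the shock -/

section Persistence

variable {e : ℝ → ℝ → ℝ} {vMin s : ℝ} {S : Set ℝ} {d : ℕ} {R₀ T : ℝ} {x₁ x₂ U : ℝ → ℝ} {L P : Flow}

/-- On a time interval where `K² t / R₀ ≤ η` the jump of density cannot change sign. At a first
time `t₁` where it vanishes, the jump conditions give `w₂⁻ = w₂⁺` on the shock, whereas
`w₂⁻ ≥ a - 2 η > M + 2 η ≥ w₂⁺` up to that time. -/
lemma IsShockFlow.density_lt (h : IsShockFlow e vMin s d R₀ T x₁ x₂ U L P)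
    (hB : IsBetheWeyl e vMin S) (hs : s ∈ S) (hG : IsAdmissibleGas e vMin s) (hd : d = 2 ∨ d = 3)
    {C₀ t a m M η K : ℝ} (hR : 0 < R₀) (hC : 0 < C₀) (ht : t ∈ Ico 0 T)
    (ha : ∀ τ ∈ Icc 0 t, a ≤ L.w₁ e s τ (x₁ τ)) (hx : ∀ τ ∈ Icc 0 t, R₀ ≤ x₁ τ)
    (hder : ∀ t ∈ Ico 0 T, ∀ r ∈ Ioi (x₂ t), -C₀ / r ≤ deriv (fun x => P.w₁ e s t x) r)
    (hm : ∀ r, R₀ ≤ r → m ≤ P.w₁ e s 0 r) (hM : ∀ r, R₀ ≤ r → P.w₂ e s 0 r ≤ M)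
    (hη : 0 < η) (hη1 : 2 * η ≤ 1) (hηt : K ^ 2 / R₀ * t ≤ η) (hηa : 5 * η ≤ a + m)
    (hηM : 4 * η < a - M) (hma : m ≤ a) (hK : 0 < K) (haK : a ≤ K) (hmK : -K ≤ m - 1) :
    ∀ τ ∈ Icc 0 t, P.ρ τ (x₂ τ) < L.ρ τ (x₂ τ) := by
  have hI : Icc 0 t ⊆ Ico 0 T := fun τ hτ => ⟨hτ.1, hτ.2.trans_lt ht.2⟩
  have hx₂ := h.continuousOn₂.mono hI
  have hmono := primH_strictMonoOn hB hs hG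
  have hLm : ∀ τ ∈ Icc 0 t, L.ρ τ (x₂ τ) ∈ densities vMin := fun τ hτ =>
    h.regular_zero.density_mem (h.right_mem_domZero (hI hτ))
  have hPm : ∀ τ ∈ Icc 0 t, P.ρ τ (x₂ τ) ∈ densities vMin := fun τ hτ =>
    h.regular_plus.density_mem (right_mem_domPlus (hI hτ))
  have hφ : ContinuousOn
      (fun τ => primH e s (L.ρ τ (x₂ τ)) - primH e s (P.ρ τ (x₂ τ))) (Icc 0 t) :=
    (continuousOn_graph h.regular_zero.continuousOn_primH hx₂
      fun τ hτ => h.right_mem_domZero (hI hτ)).sub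
    (continuousOn_graph h.regular_plus.continuousOn_primH hx₂
      fun τ hτ => right_mem_domPlus (hI hτ))
  have hψ : ContinuousOn (fun τ => L.w₂ e s τ (x₂ τ) - P.w₂ e s τ (x₂ τ)) (Icc 0 t) :=
    (continuousOn_graph h.regular_zero.contDiffOn_w₂.continuousOn hx₂
      fun τ hτ => h.right_mem_domZero (hI hτ)).sub
    (continuousOn_graph h.regular_plus.contDiffOn_w₂.continuousOn hx₂
      fun τ hτ => right_mem_domPlus (hI hτ))
  by_contra! hc
  obtain ⟨τ₀, hτ₀, hτ₀'⟩ := hc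
  have hbad : IsCompact {τ ∈ Icc 0 t |
      primH e s (L.ρ τ (x₂ τ)) - primH e s (P.ρ τ (x₂ τ)) ≤ 0} :=
    isCompact_Icc.of_isClosed_subset
      (hφ.preimage_isClosed_of_isClosed isClosed_Icc (isClosed_Iic (a := (0 : ℝ))))
      fun τ hτ => hτ.1
  obtain ⟨t₁, ⟨ht₁, ht₁'⟩, hmin⟩ := hbad.exists_isLeast
    ⟨τ₀, hτ₀, sub_nonpos.2 (hmono.monotoneOn (hLm τ₀ hτ₀) (hPm τ₀ hτ₀) hτ₀')⟩
  have hpos : ∀ τ ∈ Ico 0 t₁, 0 < primH e s (L.ρ τ (x₂ τ)) - primH e s (P.ρ τ (x₂ τ)) := by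
    intro τ hτ
    by_contra! hcon
    exact absurd (hmin ⟨⟨hτ.1, hτ.2.le.trans ht₁.2⟩, hcon⟩) (not_le.2 hτ.2)
  have ht₁0 : 0 < t₁ := by
    refine ht₁.1.lt_of_ne fun h0 => ?_
    have h1 := h.initial_compression
    rw [← h.start₂, h0] at h1
    have h2 := hmono (hPm t₁ ht₁) (hLm t₁ ht₁) h1
    linarith
  have hlt : ∀ τ ∈ Ico 0 t₁, P.ρ τ (x₂ τ) < L.ρ τ (x₂ τ) := fun τ hτ => by
    have hτt : τ ∈ Icc 0 t := ⟨hτ.1, hτ.2.le.trans ht₁.2⟩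
    exact (hmono.lt_iff_lt (hPm τ hτt) (hLm τ hτt)).1 (sub_pos.1 (hpos τ hτ))
  have hgap : ∀ τ ∈ Ico 0 t₁, a - M - 4 * η ≤ L.w₂ e s τ (x₂ τ) - P.w₂ e s τ (x₂ τ) := by
    intro τ hτ
    have hτt : τ ≤ t := hτ.2.le.trans ht₁.2
    have hsub : Icc 0 τ ⊆ Icc 0 t := Icc_subset_Icc_right hτt
    have hτT : τ ∈ Ico 0 T := hI ⟨hτ.1, hτt⟩
    have hlax : ∀ σ ∈ Icc 0 τ, P.ρ σ (x₂ σ) < L.ρ σ (x₂ σ) := fun σ hσ =>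
      hlt σ ⟨hσ.1, hσ.2.trans_lt hτ.2⟩
    have hτη : K ^ 2 / R₀ * τ ≤ η :=
      (mul_le_mul_of_nonneg_left hτt (by positivity)).trans hηt
    have hp := h.bounds_plus hB hs hG hd hR hC hτT
      (fun σ hσ => (hx σ (hsub hσ)).trans (h.le (hI (hsub hσ)))) hder hm hM hlax hη
      (by linarith) hK hmK
    have hz := h.bounds_zero hB hs hG hd hR hτT (fun σ hσ => ha σ (hsub hσ))
      (fun σ hσ => hx σ (hsub hσ))
      (fun σ hσ => (hp (σ, x₂ σ) (right_mem_domPlus (hI (hsub hσ))) hσ.2).1) hlax hη hτη hηa hma hK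
      haK
    have h1 := (hp (τ, x₂ τ) (right_mem_domPlus hτT) le_rfl).2
    have h2 := (hz (τ, x₂ τ) ⟨⟨hτ.1, le_rfl⟩, h.le hτT, le_rfl⟩).1
    simp only at h1 h2
    linarith
  have hcl : closure (Ico 0 t₁) = Icc 0 t₁ := closure_Ico ht₁0.ne
  have hsub : closure (Ico 0 t₁) ⊆ Icc 0 t := hcl.trans_subset (Icc_subset_Icc_right ht₁.2)
  have hmem : t₁ ∈ closure (Ico 0 t₁) := by rw [hcl]; exact ⟨ht₁.1, le_rfl⟩
  have h1 := le_on_closure (fun τ hτ => (hpos τ hτ).le) continuousOn_const (hφ.mono hsub) hmem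
  have h2 := le_on_closure hgap continuousOn_const (hψ.mono hsub) hmem
  beta_reduce at h1 h2
  have h3 : primH e s (L.ρ t₁ (x₂ t₁)) = primH e s (P.ρ t₁ (x₂ t₁)) := by linarith
  have h4 := hmono.injOn (hLm t₁ ht₁) (hPm t₁ ht₁) h3
  have h5 := h.jump_velocity t₁ (hI ht₁)
  rw [h4, sub_self, zero_mul, Real.sqrt_zero] at h5
  rw [Flow.w₂, Flow.w₂, h3] at h2
  linarith

end Persistence

/-! ### Existence of the characteristics in `D₀` -/

section Characteristics

/-- An integral curve on `[0, t]` of a field that is given on a strip and extended by its boundary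
values. -/
lemma exists_clamped_integralCurve {g : ℝ × ℝ → ℝ} {f₁ f₂ : ℝ → ℝ} {t : ℝ} (ht : 0 ≤ t)
    (h₁ : ContinuousOn f₁ (Icc 0 t)) (h₂ : ContinuousOn f₂ (Icc 0 t))
    (hle : ∀ τ ∈ Icc 0 t, f₁ τ ≤ f₂ τ) (hg : ContinuousOn g (strip t f₁ f₂)) {K : NNReal}
    (hlip : ∀ τ ∈ Icc 0 t, ∀ x ∈ Icc (f₁ τ) (f₂ τ), ∀ y ∈ Icc (f₁ τ) (f₂ τ),
      |g (τ, x) - g (τ, y)| ≤ K * |x - y|) (r : ℝ) :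
    ∃ X : ℝ → ℝ, X t = r ∧ ∀ τ ∈ Icc 0 t,
      HasDerivWithinAt X (g (τ, max (f₁ τ) (min (X τ) (f₂ τ)))) (Icc 0 t) τ := by
  have hmem : ∀ τ ∈ Icc 0 t, ∀ x, max (f₁ τ) (min x (f₂ τ)) ∈ Icc (f₁ τ) (f₂ τ) := fun τ hτ x =>
    ⟨le_max_left _ _, max_le (hle τ hτ) (min_le_right _ _)⟩
  obtain ⟨B, hB⟩ := (isCompact_strip h₁ h₂).exists_bound_of_continuousOn hg
  refine exists_integralCurve (f := fun τ x => g (τ, max (f₁ τ) (min x (f₂ τ)))) (K := K)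
    (B := B.toNNReal) ht r (fun τ hτ => LipschitzWith.of_dist_le_mul fun x y => ?_) (fun x => ?_)
    fun τ hτ x => ?_
  · have h3 : LipschitzWith 1 fun x => max (f₁ τ) (min x (f₂ τ)) :=
      (LipschitzWith.id.min_const _).const_max _
    have h4 := h3.dist_le_mul x y
    rw [NNReal.coe_one, one_mul] at h4
    exact (hlip τ hτ _ (hmem τ hτ x) _ (hmem τ hτ y)).trans
      (mul_le_mul_of_nonneg_left h4 K.coe_nonneg)
  · exact continuousOn_graph hg (ContinuousOn.sup h₁ (ContinuousOn.inf continuousOn_const h₂))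
      fun τ hτ => ⟨hτ, hmem τ hτ x⟩
  · exact (hB (τ, _) ⟨hτ, hmem τ hτ x⟩).trans (Real.le_coe_toNNReal B)

/-- A continuous function that is nonpositive at `0` and nonnegative at `t` has a last zero before
it stays nonnegative. -/
lemma exists_last_zero {f : ℝ → ℝ} {t : ℝ} (ht : 0 ≤ t) (hf : ContinuousOn f (Icc 0 t))
    (h0 : f 0 ≤ 0) (h1 : 0 ≤ f t) : ∃ α ∈ Icc 0 t, f α = 0 ∧ ∀ τ ∈ Icc α t, 0 ≤ f τ := by
  have hc : IsCompact {τ ∈ Icc 0 t | f τ ≤ 0} := isCompact_Icc.of_isClosed_subset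
    (hf.preimage_isClosed_of_isClosed isClosed_Icc (isClosed_Iic (a := (0 : ℝ)))) fun τ hτ => hτ.1
  obtain ⟨α, ⟨hα, hα'⟩, hmax⟩ := hc.exists_isGreatest ⟨0, ⟨le_rfl, ht⟩, h0⟩
  have hpos : ∀ τ ∈ Ioc α t, 0 ≤ f τ := fun τ hτ => by
    by_contra! hcon
    exact absurd (hmax ⟨⟨hα.1.trans hτ.1.le, hτ.2⟩, hcon.le⟩) (not_le.2 hτ.1)
  have hα0 : 0 ≤ f α := by
    rcases hα.2.eq_or_lt with h2 | h2
    · rwa [h2]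
    · have hcl : closure (Ioc α t) = Icc α t := closure_Ioc h2.ne
      refine le_on_closure hpos continuousOn_const (hf.mono ?_) (x := α) ?_
      · exact hcl.trans_subset (Icc_subset_Icc_left hα.1)
      · rw [hcl]; exact ⟨le_rfl, h2.le⟩
  refine ⟨α, hα, le_antisymm hα' hα0, fun τ hτ => ?_⟩
  rcases hτ.1.eq_or_lt with h2 | h2
  · rwa [← h2]
  · exact hpos τ ⟨h2, hτ.2⟩

variable {e : ℝ → ℝ → ℝ} {vMin s : ℝ} {S : Set ℝ} {d : ℕ} {R₀ T : ℝ} {x₁ x₂ U : ℝ → ℝ} {L P : Flow}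

lemma IsShockFlow.exists_lipschitz (h : IsShockFlow e vMin s d R₀ T x₁ x₂ U L P) {f : ℝ × ℝ → ℝ}
    (hf : ContDiffOn ℝ 1 f (domZero T x₁ x₂)) {t : ℝ} (ht : t < T) :
    ∃ B : ℝ, ∀ τ ∈ Icc 0 t, ∀ x ∈ Icc (x₁ τ) (x₂ τ), ∀ y ∈ Icc (x₁ τ) (x₂ τ),
      |f (τ, x) - f (τ, y)| ≤ B * |x - y| := by
  obtain ⟨B, hB⟩ := exists_norm_fderiv_le hf (h.isCompact_strip ht) (strip_subset_domZero ht)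
  refine ⟨B, fun τ hτ x hx y hy => ?_⟩
  wlog hxy : y < x generalizing x y
  · rcases (not_lt.1 hxy).eq_or_lt with h1 | h1
    · simp [h1]
    · rw [abs_sub_comm, abs_sub_comm x]
      exact this y hy x hx h1
  -- the section of `D₀` at time `0` is a single point
  have hτ0 : 0 < τ := by
    refine hτ.1.lt_of_ne fun h0 => ?_
    have h1 := (hy.1.trans_lt hxy).trans_le hx.2
    rw [← h0, h.start₁, h.start₂] at h1
    exact lt_irrefl _ h1
  have hτT : τ ∈ Ioo 0 T := ⟨hτ0, hτ.2.trans_lt ht⟩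
  have hd : ∀ z ∈ Ioo y x, HasDerivAt (fun z => f (τ, z)) (fderiv ℝ f (τ, z) (0, 1)) z := by
    intro z hz
    have hi := h.mem_interior_domZero hτT ⟨hy.1.trans_lt hz.1, hz.2.trans_le hx.2⟩
    have h1 := ((hf.contDiffAt (mem_interior_iff_mem_nhds.1 hi)).differentiableAt
      one_ne_zero).hasFDerivAt
    have := h1.comp_hasDerivAt z ((hasDerivAt_const z τ).prodMk (hasDerivAt_id z))
    exact this
  have hc : ContinuousOn (fun z => f (τ, z)) (Icc y x) :=
    hf.continuousOn.comp (f := fun z : ℝ => (τ, z)) (by fun_prop)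
      fun z hz => ⟨⟨hτ.1, hτT.2⟩, hy.1.trans hz.1, hz.2.trans hx.2⟩
  obtain ⟨ξ, hξ, hξe⟩ := exists_hasDerivAt_eq_slope _ _ hxy hc hd
  have h2 : ‖fderiv ℝ f (τ, ξ) (0, 1)‖ ≤ B := by
    have h3 := hB (τ, ξ) ⟨⟨hτ, hy.1.trans hξ.1.le, hξ.2.le.trans hx.2⟩,
      h.mem_interior_domZero hτT ⟨hy.1.trans_lt hξ.1, hξ.2.trans_le hx.2⟩⟩
    refine (ContinuousLinearMap.le_opNorm _ _).trans ?_
    simpa [Prod.norm_def] using h3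
  rw [hξe, Real.norm_eq_abs, abs_div, div_le_iff₀ (abs_pos.2 (sub_pos.2 hxy).ne')] at h2
  exact h2

/-- Both characteristic speeds are Lipschitz in `r` on `D₀`, up to its boundary, since `c` is a
Lipschitz function of `w₂ - w₁`. -/
lemma IsShockFlow.exists_lipschitz_speed (h : IsShockFlow e vMin s d R₀ T x₁ x₂ U L P)
    (hB : IsBetheWeyl e vMin S) (hs : s ∈ S) (hG : IsAdmissibleGas e vMin s) {t : ℝ} (ht : t < T) :
    ∃ K : NNReal, ∀ τ ∈ Icc 0 t, ∀ x ∈ Icc (x₁ τ) (x₂ τ), ∀ y ∈ Icc (x₁ τ) (x₂ τ),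
      |L.speed₁ e s τ x - L.speed₁ e s τ y| ≤ K * |x - y| ∧
      |L.speed₂ e s τ x - L.speed₂ e s τ y| ≤ K * |x - y| := by
  obtain ⟨B₁, h₁⟩ := h.exists_lipschitz h.regular_zero.contDiffOn_w₁ ht
  obtain ⟨B₂, h₂⟩ := h.exists_lipschitz h.regular_zero.contDiffOn_w₂ ht
  refine ⟨(B₁ + B₂).toNNReal, fun τ hτ x hx y hy => ?_⟩
  have hτT : τ ∈ Ico 0 T := ⟨hτ.1, hτ.2.trans_lt ht⟩
  have e1 := h₁ τ hτ x hx y hy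
  have e2 := h₂ τ hτ x hx y hy
  have e3 := abs_soundSpeed_sub_le hB hs hG
    (h.regular_zero.density_mem (z := (τ, x)) ⟨hτT, hx⟩)
    (h.regular_zero.density_mem (z := (τ, y)) ⟨hτT, hy⟩)
  simp only [L.primH_eq] at e3 e1 e2
  have e4 : (B₁ + B₂) * |x - y| ≤ (B₁ + B₂).toNNReal * |x - y| :=
    mul_le_mul_of_nonneg_right (Real.le_coe_toNNReal _) (abs_nonneg _)
  have e5 : |L.w₁ e s τ x - L.w₁ e s τ y| + |L.w₂ e s τ x - L.w₂ e s τ y|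
      ≤ (B₁ + B₂) * |x - y| := by linarith
  have e6 : |(L.w₂ e s τ x - L.w₁ e s τ x) / 2 - (L.w₂ e s τ y - L.w₁ e s τ y) / 2|
      ≤ (|L.w₁ e s τ x - L.w₁ e s τ y| + |L.w₂ e s τ x - L.w₂ e s τ y|) / 2 := by
    rw [abs_le]
    constructor <;>
      linarith [le_abs_self (L.w₁ e s τ x - L.w₁ e s τ y), neg_abs_le (L.w₁ e s τ x - L.w₁ e s τ y),
        le_abs_self (L.w₂ e s τ x - L.w₂ e s τ y), neg_abs_le (L.w₂ e s τ x - L.w₂ e s τ y)]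
  have e7 := abs_le.1 (e3.trans e6)
  simp only [Flow.speed₁, Flow.speed₂, L.u_eq e s]
  constructor
  all_goals
    refine le_trans ?_ (e5.trans e4)
    rw [abs_le]
    constructor <;>
      linarith [le_abs_self (L.w₁ e s τ x - L.w₁ e s τ y), neg_abs_le (L.w₁ e s τ x - L.w₁ e s τ y),
        le_abs_self (L.w₂ e s τ x - L.w₂ e s τ y), neg_abs_le (L.w₂ e s τ x - L.w₂ e s τ y),
        e7.1, e7.2]

/-- Backward in time a 1-characteristic of `D₀` cannot cross the curve `r = x₁`, itself a
1-characteristic, so that it comes from the shock. -/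
lemma IsShockFlow.exists_char₁ (h : IsShockFlow e vMin s d R₀ T x₁ x₂ U L P)
    (hB : IsBetheWeyl e vMin S) (hs : s ∈ S) (hG : IsAdmissibleGas e vMin s) {t r : ℝ}
    (ht : t ∈ Ico 0 T) (hr : r ∈ Icc (x₁ t) (x₂ t)) :
    ∃ α X, IsChar₁ e s T x₁ x₂ L X α t r := by
  have hI : Icc 0 t ⊆ Ico 0 T := fun τ hτ => ⟨hτ.1, hτ.2.trans_lt ht.2⟩
  have hx₁ := h.continuousOn₁.mono hI
  have hx₂ := h.continuousOn₂.mono hI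
  obtain ⟨K, hK⟩ := h.exists_lipschitz_speed hB hs hG ht.2
  have hF := h.regular_zero
  obtain ⟨X, hXt, hX⟩ := exists_clamped_integralCurve (g := fun z => L.speed₁ e s z.1 z.2) ht.1
    hx₁ hx₂ (fun τ hτ => h.le (hI hτ))
    ((hF.continuousOn_u.sub (hF.continuousOn_soundSpeed hB hs hG)).mono
      (strip_subset_domZero ht.2)) (fun τ hτ x hx y hy => (hK τ hτ x hx y hy).1) r
  have hXc : ContinuousOn X (Icc 0 t) := fun τ hτ => (hX τ hτ).continuousWithinAt
  have hge : ∀ τ ∈ Icc 0 t, x₁ τ ≤ X τ := by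
    intro τ₀ hτ₀
    by_contra! hc
    have hsub : Icc τ₀ t ⊆ Icc 0 t := Icc_subset_Icc_left hτ₀.1
    have hg : ContinuousOn (fun τ => x₁ τ - X τ) (Icc τ₀ t) := (hx₁.sub hXc).mono hsub
    -- below `x₁` the extended field is the speed of `x₁`, so that `x₁ - X` is constant there
    have key : ∀ τ ∈ Ioo τ₀ t, 0 < x₁ τ - X τ →
        ∃ y, 0 ≤ y ∧ HasDerivAt (fun τ => x₁ τ - X τ) y τ := by
      intro τ hτ hpos
      have hτ' : τ ∈ Ioo 0 t := ⟨hτ₀.1.trans_lt hτ.1, hτ.2⟩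
      have h1 := (hX τ ⟨hτ'.1.le, hτ'.2.le⟩).hasDerivAt (Icc_mem_nhds hτ'.1 hτ'.2)
      rw [max_eq_left ((min_le_left _ _).trans (sub_pos.1 hpos).le)] at h1
      exact ⟨_, (sub_self _).ge, (h.hasDerivAt₁ ⟨hτ'.1, hτ'.2.trans ht.2⟩).sub h1⟩
    have := (le_of_deriv_nonneg_of_pos hτ₀.2 hg hg (sub_pos.2 hc) (sub_pos.2 hc)
      fun τ hτ hp _ => ⟨key τ hτ hp, key τ hτ hp⟩).1
    rw [hXt] at this
    linarith [hr.1]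
  obtain ⟨α, hα, hα0, hpos⟩ := exists_last_zero ht.1 (hx₂.sub hXc)
    (by
      have := hge 0 ⟨le_rfl, ht.1⟩
      simp only [Pi.sub_apply]
      rw [h.start₁] at this
      rw [h.start₂]
      linarith)
    (by simp only [Pi.sub_apply, hXt]; linarith [hr.2])
  refine ⟨α, X, hα, (sub_eq_zero.1 hα0).symm, hXt, fun τ hτ => ?_⟩
  have hτ0 : τ ∈ Icc 0 t := ⟨hα.1.trans hτ.1, hτ.2⟩
  have h1 := hge τ hτ0
  have h2 : X τ ≤ x₂ τ := sub_nonneg.1 (hpos τ hτ)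
  have h3 := hX τ hτ0
  rw [min_eq_left h2, max_eq_right h1] at h3
  exact ⟨⟨hI hτ0, h1, h2⟩, h3.mono (Icc_subset_Icc_left hα.1)⟩

/-- Backward in time a 2-characteristic of `D₀` cannot cross the shock, which is slower by Lax's
condition, so that it comes from the curve `r = x₁`. -/
lemma IsShockFlow.exists_char₂ (h : IsShockFlow e vMin s d R₀ T x₁ x₂ U L P)
    (hB : IsBetheWeyl e vMin S) (hs : s ∈ S) (hG : IsAdmissibleGas e vMin s) {t r : ℝ}
    (ht : t ∈ Ico 0 T) (hlax : ∀ τ ∈ Icc 0 t, P.ρ τ (x₂ τ) < L.ρ τ (x₂ τ))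
    (hr : r ∈ Icc (x₁ t) (x₂ t)) :
    ∃ β X, IsChar₂ e s T x₁ x₂ L X β t r := by
  have hI : Icc 0 t ⊆ Ico 0 T := fun τ hτ => ⟨hτ.1, hτ.2.trans_lt ht.2⟩
  have hx₁ := h.continuousOn₁.mono hI
  have hx₂ := h.continuousOn₂.mono hI
  obtain ⟨K, hK⟩ := h.exists_lipschitz_speed hB hs hG ht.2
  have hF := h.regular_zero
  obtain ⟨X, hXt, hX⟩ := exists_clamped_integralCurve (g := fun z => L.speed₂ e s z.1 z.2) ht.1
    hx₁ hx₂ (fun τ hτ => h.le (hI hτ))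
    ((hF.continuousOn_u.add (hF.continuousOn_soundSpeed hB hs hG)).mono
      (strip_subset_domZero ht.2)) (fun τ hτ x hx y hy => (hK τ hτ x hx y hy).2) r
  have hXc : ContinuousOn X (Icc 0 t) := fun τ hτ => (hX τ hτ).continuousWithinAt
  have hge : ∀ τ ∈ Icc 0 t, X τ ≤ x₂ τ := by
    intro τ₀ hτ₀
    by_contra! hc
    have hsub : Icc τ₀ t ⊆ Icc 0 t := Icc_subset_Icc_left hτ₀.1
    have hg : ContinuousOn (fun τ => X τ - x₂ τ) (Icc τ₀ t) := (hXc.sub hx₂).mono hsub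
    -- beyond the shock the extended field is `u⁻ + c⁻ > U`, so that `X - x₂` increases there
    have key : ∀ τ ∈ Ioo τ₀ t, 0 < X τ - x₂ τ →
        ∃ y, 0 ≤ y ∧ HasDerivAt (fun τ => X τ - x₂ τ) y τ := by
      intro τ hτ hpos
      have hτ' : τ ∈ Ioo 0 t := ⟨hτ₀.1.trans_lt hτ.1, hτ.2⟩
      have hτI : τ ∈ Icc 0 t := ⟨hτ'.1.le, hτ'.2.le⟩
      have h1 := (hX τ hτI).hasDerivAt (Icc_mem_nhds hτ'.1 hτ'.2)
      rw [min_eq_right (sub_pos.1 hpos).le, max_eq_right (h.le (hI hτI))] at h1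
      have h2 := (lax_inequalities hB hs (hy := hF.density_mem (h.right_mem_domZero (hI hτI)))
            (h.density_right_pos _ (hI hτI)) (hlax _ hτI) (h.jump_mass _ (hI hτI))
            (h.jump_velocity _ (hI hτI))).2
      exact ⟨_, (sub_pos.2 h2).le, h1.sub (h.hasDerivAt₂ ⟨hτ'.1, hτ'.2.trans ht.2⟩)⟩
    have := (le_of_deriv_nonneg_of_pos hτ₀.2 hg hg (sub_pos.2 hc) (sub_pos.2 hc)
      fun τ hτ hp _ => ⟨key τ hτ hp, key τ hτ hp⟩).1
    rw [hXt] at this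
    linarith [hr.2]
  obtain ⟨β, hβ, hβ0, hpos⟩ := exists_last_zero ht.1 (hXc.sub hx₁)
    (by
      have := hge 0 ⟨le_rfl, ht.1⟩
      simp only [Pi.sub_apply]
      rw [h.start₂] at this
      rw [h.start₁]
      linarith)
    (by simp only [Pi.sub_apply, hXt]; linarith [hr.1])
  refine ⟨β, X, hβ, sub_eq_zero.1 hβ0, hXt, fun τ hτ => ?_⟩
  have hτ0 : τ ∈ Icc 0 t := ⟨hβ.1.trans hτ.1, hτ.2⟩
  have h1 := hge τ hτ0
  have h2 : x₁ τ ≤ X τ := sub_nonneg.1 (hpos τ hτ)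
  have h3 := hX τ hτ0
  rw [min_eq_left h1, max_eq_right h2] at h3
  exact ⟨⟨hI hτ0, h2, h1⟩, h3.mono (Icc_subset_Icc_left hβ.1)⟩

end Characteristics

/-! ### The estimates along the characteristics -/

section Estimates

variable {e : ℝ → ℝ → ℝ} {vMin s : ℝ} {S : Set ℝ} {d : ℕ} {R₀ T : ℝ} {x₁ x₂ U : ℝ → ℝ} {L P : Flow}

lemma IsShockFlow.hasDerivAt_along₁ (h : IsShockFlow e vMin s d R₀ T x₁ x₂ U L P)
    (hB : IsBetheWeyl e vMin S) (hs : s ∈ S) (hG : IsAdmissibleGas e vMin s) {X : ℝ → ℝ}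
    {α t τ : ℝ} (hX : IsCharacteristic (L.speed₁ e s) (domZero T x₁ x₂) X α t) (hτ : τ ∈ Ioo α t)
    (hα : 0 ≤ α) (hp : X τ ≠ 0) :
    HasDerivAt (fun σ => L.w₁ e s σ (X σ))
      (((d : ℝ) - 1) * (soundSpeed e s (L.ρ τ (X τ)) * L.u τ (X τ)) / X τ) τ := by
  obtain ⟨hz, hd⟩ := hX τ ⟨hτ.1.le, hτ.2.le⟩
  obtain ⟨A, hA, hAe⟩ := h.regular_zero.transport_w₁ hB hs hG hz
    (h.mem_closure_domZero ⟨hα.trans_lt hτ.1, hz.1.2⟩ hz.2) hp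
  have := (hasDerivWithinAt_along hA hd (fun σ hσ => (hX σ hσ).1)).hasDerivAt
    (Icc_mem_nhds hτ.1 hτ.2)
  simp only at hAe
  rwa [hAe] at this

lemma IsShockFlow.hasDerivAt_along₂ (h : IsShockFlow e vMin s d R₀ T x₁ x₂ U L P)
    (hB : IsBetheWeyl e vMin S) (hs : s ∈ S) (hG : IsAdmissibleGas e vMin s) {X : ℝ → ℝ}
    {α t τ : ℝ} (hX : IsCharacteristic (L.speed₂ e s) (domZero T x₁ x₂) X α t) (hτ : τ ∈ Ioo α t)
    (hα : 0 ≤ α) (hp : X τ ≠ 0) :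
    HasDerivAt (fun σ => L.w₂ e s σ (X σ))
      (-(((d : ℝ) - 1) * (soundSpeed e s (L.ρ τ (X τ)) * L.u τ (X τ)) / X τ)) τ := by
  obtain ⟨hz, hd⟩ := hX τ ⟨hτ.1.le, hτ.2.le⟩
  obtain ⟨A, hA, hAe⟩ := h.regular_zero.transport_w₂ hB hs hG hz
    (h.mem_closure_domZero ⟨hα.trans_lt hτ.1, hz.1.2⟩ hz.2) hp
  have := (hasDerivWithinAt_along hA hd (fun σ hσ => (hX σ hσ).1)).hasDerivAt
    (Icc_mem_nhds hτ.1 hτ.2)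
  simp only at hAe
  rwa [hAe] at this

lemma monotoneOn_Icc_of_hasDerivAt {f f' : ℝ → ℝ} {a b : ℝ} (hab : a ≤ b)
    (hf : ContinuousOn f (Icc a b)) (hd : ∀ x ∈ Ioo a b, HasDerivAt f (f' x) x)
    (h0 : ∀ x ∈ Ioo a b, 0 ≤ f' x) : f a ≤ f b := by
  refine monotoneOn_of_deriv_nonneg (convex_Icc a b) hf (fun x hx => ?_) (fun x hx => ?_)
    ⟨le_rfl, hab⟩ ⟨hab, le_rfl⟩ hab
  · rw [interior_Icc] at hx
    exact (hd x hx).differentiableAt.differentiableWithinAt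
  · rw [interior_Icc] at hx
    rw [(hd x hx).deriv]
    exact h0 x hx

/-- The `C⁰` estimates hold on `D₀` up to time `t` if Lax's condition holds on the shock and if
`w₂` and `u` are positive in `D₀`: then `0 ≤ c u ≤ w₂² / 4`. -/
lemma IsShockFlow.c0Estimates (h : IsShockFlow e vMin s d R₀ T x₁ x₂ U L P)
    (hB : IsBetheWeyl e vMin S) (hs : s ∈ S) (hG : IsAdmissibleGas e vMin s) (hd : 1 ≤ d) {t : ℝ}
    (hR : 0 < R₀) (ht : t ∈ Ico 0 T) (hx : ∀ τ ∈ Icc 0 t, R₀ ≤ x₁ τ)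
    (hxm : ∀ β ∈ Icc 0 t, ∀ τ ∈ Icc β t, x₁ β ≤ x₁ τ)
    (hlax : ∀ τ ∈ Icc 0 t, P.ρ τ (x₂ τ) < L.ρ τ (x₂ τ))
    (hw : ∀ z ∈ strip t x₁ x₂, 0 < L.w₂ e s z.1 z.2)
    (hu : ∀ z ∈ strip t x₁ x₂, 0 ≤ L.u z.1 z.2) {r : ℝ} (hr : r ∈ Icc (x₁ t) (x₂ t)) :
    C0Estimates e s d T x₁ x₂ L t r := by
  have hF := h.regular_zero
  have hk : (0 : ℝ) ≤ (d : ℝ) - 1 := by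
    have : (1 : ℝ) ≤ d := by exact_mod_cast hd
    linarith
  have hI : Icc 0 t ⊆ Ico 0 T := fun τ hτ => ⟨hτ.1, hτ.2.trans_lt ht.2⟩
  have hmem : ∀ {c : ℝ → ℝ → ℝ} {X : ℝ → ℝ} {α σ : ℝ}, 0 ≤ α → σ ≤ t →
      IsCharacteristic c (domZero T x₁ x₂) X α σ → ∀ τ ∈ Icc α σ, (τ, X τ) ∈ strip t x₁ x₂ :=
    fun hα hσ hX τ hτ => ⟨⟨hα.trans hτ.1, hτ.2.trans hσ⟩, (hX τ hτ).1.2⟩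
  have hpos : ∀ z ∈ strip t x₁ x₂, 0 < z.2 := fun z hz =>
    hR.trans_le ((hx _ hz.1).trans hz.2.1)
  have hsrc : ∀ z ∈ strip t x₁ x₂,
      0 ≤ ((d : ℝ) - 1) * (soundSpeed e s (L.ρ z.1 z.2) * L.u z.1 z.2) / z.2 := fun z hz =>
    div_nonneg (mul_nonneg hk (mul_nonneg (soundSpeed_nonneg e s _) (hu z hz))) (hpos z hz).le
  have hsrc' : ∀ z ∈ strip t x₁ x₂, ∀ K, L.w₂ e s z.1 z.2 ≤ K →
      soundSpeed e s (L.ρ z.1 z.2) * L.u z.1 z.2 ≤ K ^ 2 / 4 := fun z hz K hK => by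
    have := source_le (soundSpeed_nonneg e s _)
      (hF.soundSpeed_le hB hs hG (strip_subset_domZero ht.2 hz)) hK
    rwa [← L.u_eq] at this
  have hXc : ∀ {c : ℝ → ℝ → ℝ} {X : ℝ → ℝ} {α σ : ℝ},
      IsCharacteristic c (domZero T x₁ x₂) X α σ → ContinuousOn X (Icc α σ) :=
    fun hX τ hτ => (hX τ hτ).2.continuousWithinAt
  have hanti : ∀ {σ x β : ℝ} {X : ℝ → ℝ}, σ ≤ t → IsChar₂ e s T x₁ x₂ L X β σ x →
      L.w₂ e s σ x ≤ L.w₂ e s β (x₁ β) := by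
    intro σ x β X hσ hX
    obtain ⟨hβ, hXβ, hXσ, hch⟩ := hX
    have hm := hmem hβ.1 hσ hch
    have := monotoneOn_Icc_of_hasDerivAt hβ.2
      (continuousOn_graph hF.contDiffOn_w₂.continuousOn (hXc hch) fun τ hτ => (hch τ hτ).1).neg
      (fun τ hτ => (h.hasDerivAt_along₂ hB hs hG hch hτ hβ.1
        (hpos _ (hm τ (Ioo_subset_Icc_self hτ))).ne').neg)
      fun τ hτ => by
        rw [neg_neg]
        exact hsrc _ (hm τ (Ioo_subset_Icc_self hτ))
    simp only [Pi.neg_apply, hXβ, hXσ] at this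
    linarith
  have hbdd : BddAbove ((fun τ => |L.w₂ e s τ (x₁ τ)|) '' Icc 0 t) :=
    (isCompact_Icc.image_of_continuousOn (continuousOn_graph hF.contDiffOn_w₂.continuousOn
      (h.continuousOn₁.mono hI) fun τ hτ => h.left_mem_domZero (hI hτ)).abs).bddAbove
  have hsup : ∀ z ∈ strip t x₁ x₂,
      L.w₂ e s z.1 z.2 ≤ sSup ((fun τ => |L.w₂ e s τ (x₁ τ)|) '' Icc 0 t) := by
    intro z hz
    obtain ⟨β, X, hX⟩ := h.exists_char₂ hB hs hG (hI hz.1)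
      (fun τ hτ => hlax τ ⟨hτ.1, hτ.2.trans hz.1.2⟩) hz.2
    have h1 := hanti hz.1.2 hX
    have h2 := le_csSup hbdd (mem_image_of_mem (fun τ => |L.w₂ e s τ (x₁ τ)|)
      (show β ∈ Icc 0 t from ⟨hX.1.1, hX.1.2.trans hz.1.2⟩))
    exact h1.trans ((le_abs_self _).trans h2)
  refine ⟨h.exists_char₁ hB hs hG ht hr, h.exists_char₂ hB hs hG ht hlax hr,
    Flow.w₁_le_w₂ (z := (t, r)) hF ⟨ht, hr⟩, ?_, ?_, ?_, fun β X hX => hanti le_rfl hX⟩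
  · rintro α X ⟨hα, hXα, hXt, hch⟩
    have hm := hmem hα.1 le_rfl hch
    have := monotoneOn_Icc_of_hasDerivAt hα.2
      (continuousOn_graph hF.contDiffOn_w₁.continuousOn (hXc hch) fun τ hτ => (hch τ hτ).1)
      (fun τ hτ => h.hasDerivAt_along₁ hB hs hG hch hτ hα.1
        (hpos _ (hm τ (Ioo_subset_Icc_self hτ))).ne')
      fun τ hτ => hsrc _ (hm τ (Ioo_subset_Icc_self hτ))
    simpa only [hXα, hXt] using this
  · rintro α X ⟨hα, hXα, hXt, hch⟩
    have hm := hmem hα.1 le_rfl hch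
    set N := sSup ((fun τ => |L.w₂ e s τ (x₁ τ)|) '' Icc 0 t)
    have hint : ContinuousOn (fun τ => N ^ 2 * (((d : ℝ) - 1) / (4 * X τ))) (Icc α t) :=
      continuousOn_const.mul (continuousOn_const.div (continuousOn_const.mul (hXc hch))
        fun τ hτ => (mul_pos (by norm_num) (hpos _ (hm τ hτ))).ne')
    have := intervalIntegral.sub_le_integral_of_hasDeriv_right_of_le hα.2
      (continuousOn_graph hF.contDiffOn_w₁.continuousOn (hXc hch) fun τ hτ => (hch τ hτ).1)
      (fun τ hτ => (h.hasDerivAt_along₁ hB hs hG hch hτ hα.1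
        (hpos _ (hm τ (Ioo_subset_Icc_self hτ))).ne').hasDerivWithinAt)
      hint.integrableOn_Icc fun τ hτ => by
        have hz := hm τ (Ioo_subset_Icc_self hτ)
        have hXp : 0 < X τ := hpos _ hz
        have h1 := hsrc' _ hz N (hsup _ hz)
        calc ((d : ℝ) - 1) * (soundSpeed e s (L.ρ τ (X τ)) * L.u τ (X τ)) / X τ
            ≤ ((d : ℝ) - 1) * (N ^ 2 / 4) / X τ := by gcongr
          _ = N ^ 2 * (((d : ℝ) - 1) / (4 * X τ)) := by field_simp
    rw [intervalIntegral.integral_const_mul] at this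
    simp only [hXα, hXt] at this
    linarith
  · rintro β X ⟨hβ, hXβ, hXt, hch⟩
    have hm := hmem hβ.1 le_rfl hch
    have hx0 : 0 < x₁ β := hR.trans_le (hx β hβ)
    have hy : ∀ τ ∈ Icc β t, 0 < L.w₂ e s τ (X τ) := fun τ hτ => hw _ (hm τ hτ)
    -- Riccati's inequality `w₂' ≥ -(d - 1) w₂² / (4 x₁(β))`, in terms of `1 / w₂`
    have := monotoneOn_Icc_of_hasDerivAt hβ.2
      (f := fun τ => ((d : ℝ) - 1) / (4 * x₁ β) * τ - (L.w₂ e s τ (X τ))⁻¹)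
      ((continuousOn_const.mul continuousOn_id).sub
        ((continuousOn_graph hF.contDiffOn_w₂.continuousOn (hXc hch)
          fun τ hτ => (hch τ hτ).1).inv₀ fun τ hτ => (hy τ hτ).ne'))
      (fun τ hτ => ((hasDerivAt_id τ).const_mul (((d : ℝ) - 1) / (4 * x₁ β))).sub
        ((h.hasDerivAt_along₂ hB hs hG hch hτ hβ.1
          (hpos _ (hm τ (Ioo_subset_Icc_self hτ))).ne').inv (hy τ (Ioo_subset_Icc_self hτ)).ne'))
      fun τ hτ => by
        have hτ' := Ioo_subset_Icc_self hτ
        have hz := hm τ hτ'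
        have hyp := hy τ hτ'
        have h1 := hsrc' _ hz _ le_rfl
        have h2 : x₁ β ≤ X τ := (hxm β hβ τ hτ').trans hz.2.1
        simp only at h1
        rw [neg_neg, mul_one, sub_nonneg, div_le_iff₀ (by positivity)]
        calc ((d : ℝ) - 1) * (soundSpeed e s (L.ρ τ (X τ)) * L.u τ (X τ)) / X τ
            ≤ ((d : ℝ) - 1) * (L.w₂ e s τ (X τ) ^ 2 / 4) / X τ := by
              have := hx0.trans_le h2
              gcongr
          _ ≤ ((d : ℝ) - 1) * (L.w₂ e s τ (X τ) ^ 2 / 4) / x₁ β := by gcongr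
          _ = ((d : ℝ) - 1) / (4 * x₁ β) * L.w₂ e s τ (X τ) ^ 2 := by field_simp
    have hy0 := hy β ⟨le_rfl, hβ.2⟩
    have hyt := hy t ⟨hβ.2, le_rfl⟩
    simp only [hXβ, hXt] at this hy0 hyt
    set y₀ := L.w₂ e s β (x₁ β)
    have hβt : 0 ≤ t - β := sub_nonneg.2 hβ.2
    have h3 : (L.w₂ e s t r)⁻¹ ≤ (1 + y₀ / x₁ β * (((d : ℝ) - 1) * (t - β) / 4)) / y₀ := by
      have h4 : (1 + y₀ / x₁ β * (((d : ℝ) - 1) * (t - β) / 4)) / y₀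
          = y₀⁻¹ + ((d : ℝ) - 1) / (4 * x₁ β) * (t - β) := by field_simp
      rw [h4]
      linarith
    have h5 := inv_anti₀ (inv_pos.2 hyt) h3
    rwa [inv_inv, inv_div] at h5

end Estimates

end RadialShock

open RadialShock in
theorem mainTheorem5 (d : ℕ) (hd : d = 2 ∨ d = 3) (a m M : ℝ)
    (ham : 0 < a + m) (haM : M < a) :
    ∃ C : ℝ, 0 < C ∧
      ∀ (e : ℝ → ℝ → ℝ) (vMin : ℝ) (S : Set ℝ) (s : ℝ),
        IsBetheWeyl e vMin S → s ∈ S → IsAdmissibleGas e vMin s →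
      ∀ (R₀ T C₀ : ℝ) (x₁ x₂ U : ℝ → ℝ) (L P : Flow),
        0 < R₀ → 0 < T → 0 < C₀ →
        IsShockFlow e vMin s d R₀ T x₁ x₂ U L P →
        (∃ ε > 0, ∀ r ∈ Set.Ioc 0 R₀, ε ≤ L.w₁ e s 0 r) →
        L.w₁ e s 0 R₀ = a →
        IsGLB ((fun r => P.w₁ e s 0 r) '' Set.Ici R₀) m →
        IsLUB ((fun r => P.w₂ e s 0 r) '' Set.Ici R₀) M →
        (∀ t ∈ Set.Ico 0 T, ∀ r ∈ Set.Ioo 0 (x₁ t),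
          |deriv (fun x => L.w₂ e s t x) r| ≤ C₀ / r) →
        (∀ t ∈ Set.Ico 0 T, ∀ r ∈ Set.Ioi (x₂ t),
          -C₀ / r ≤ deriv (fun x => P.w₁ e s t x) r ∧
          deriv (fun x => P.w₂ e s t x) r ≤ C₀ / r) →
      ∀ t : ℝ, 0 ≤ t → t < T → t < C * R₀ →
        P.ρ t (x₂ t) < L.ρ t (x₂ t) ∧
        ∀ r ∈ Set.Icc (x₁ t) (x₂ t), C0Estimates e s d T x₁ x₂ L t r := by
  -- `η` is the loss allowed in the bounds; `K` bounds the invariant that enters each source term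
  obtain ⟨η, hη, hη1, hηa, hηM⟩ : ∃ η : ℝ, 0 < η ∧ 2 * η ≤ 1 ∧ 5 * η ≤ a + m ∧ 4 * η < a - M := by
    refine ⟨min 1 (min (a + m) (a - M)) / 5, ?_, ?_, ?_, ?_⟩
    · have : 0 < min 1 (min (a + m) (a - M)) := lt_min one_pos (lt_min ham (sub_pos.2 haM))
      positivity
    · linarith [min_le_left 1 (min (a + m) (a - M))]
    · linarith [(min_le_right 1 (min (a + m) (a - M))).trans (min_le_left _ _)]
    · linarith [(min_le_right 1 (min (a + m) (a - M))).trans (min_le_right _ _)]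
  obtain ⟨K, hK, haK, hmK⟩ : ∃ K : ℝ, 0 < K ∧ a ≤ K ∧ -K ≤ m - 1 :=
    ⟨|a| + |m| + 1, by positivity, by linarith [le_abs_self a, abs_nonneg m],
      by linarith [neg_abs_le m, abs_nonneg a]⟩
  refine ⟨η / K ^ 2, by positivity, ?_⟩
  intro e vMin S s hB hs hG R₀ T C₀ x₁ x₂ U L P hR hT hC h _ hwa hm hM _ hder t ht0 htT htC
  have ht : t ∈ Set.Ico 0 T := ⟨ht0, htT⟩
  have h0T : (0 : ℝ) ∈ Set.Ico 0 T := ⟨le_rfl, hT⟩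
  have hd1 : 1 ≤ d := by omega
  have hm' : ∀ r, R₀ ≤ r → m ≤ P.w₁ e s 0 r := fun r hr => hm.1 (Set.mem_image_of_mem _ hr)
  have hM' : ∀ r, R₀ ≤ r → P.w₂ e s 0 r ≤ M := fun r hr => hM.1 (Set.mem_image_of_mem _ hr)
  have hmM : m ≤ M := by
    have h1 := Flow.w₁_le_w₂ h.regular_plus (z := (0, R₀)) ⟨h0T, by simp [h.start₂]⟩
    exact ((hm' R₀ le_rfl).trans h1).trans (hM' R₀ le_rfl)
  have ha0 : 0 < a := by linarith
  have hηt : K ^ 2 / R₀ * t ≤ η := by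
    rw [div_mul_eq_mul_div, lt_div_iff₀ (by positivity)] at htC
    rw [div_mul_eq_mul_div, div_le_iff₀ hR]
    linarith
  have hleft : ∀ τ ∈ Set.Ico 0 T, a ≤ L.w₁ e s τ (x₁ τ) ∧ R₀ ≤ x₁ τ := fun τ hτ => by
    have := h.monotone_left hB hs hG hd1 le_rfl hτ.1 hτ.2 (by rwa [h.start₁, hwa])
      (by rwa [h.start₁])
    rwa [h.start₁, hwa] at this
  have hI : Set.Icc 0 t ⊆ Set.Ico 0 T := fun τ hτ => ⟨hτ.1, hτ.2.trans_lt htT⟩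
  have hderP : ∀ t ∈ Set.Ico 0 T, ∀ r ∈ Set.Ioi (x₂ t),
    -C₀ / r ≤ deriv (fun x => P.w₁ e s t x) r := fun t ht r hr => (hder t ht r hr).1
  have hlax := h.density_lt hB hs hG hd hR hC ht (fun τ hτ => (hleft τ (hI hτ)).1)
    (fun τ hτ => (hleft τ (hI hτ)).2) hderP hm' hM' hη hη1 hηt hηa hηM (by linarith) hK haK hmK
  have hplus := h.bounds_plus hB hs hG hd hR hC ht
    (fun τ hτ => ((hleft τ (hI hτ)).2).trans (h.le (hI hτ))) hderP hm' hM' hlax hη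
    (by linarith) hK hmK
  have hzero := h.bounds_zero hB hs hG hd hR ht (fun τ hτ => (hleft τ (hI hτ)).1)
    (fun τ hτ => (hleft τ (hI hτ)).2)
    (fun τ hτ => (hplus (τ, x₂ τ) (right_mem_domPlus (hI hτ)) hτ.2).1) hlax hη hηt hηa
    (by linarith) hK haK
  have hκ : ∀ z ∈ strip t x₁ x₂, K ^ 2 / R₀ * z.1 ≤ η := fun z hz =>
    (mul_le_mul_of_nonneg_left hz.1.2 (by positivity)).trans hηt
  refine ⟨hlax t ⟨ht0, le_rfl⟩, fun r hr => h.c0Estimates hB hs hG hd1 hR ht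
    (fun τ hτ => (hleft τ (hI hτ)).2) (fun β hβ τ hτ => ?_) hlax (fun z hz => ?_)
    (fun z hz => ?_) hr⟩
  · have hβ' := hleft β (hI hβ)
    exact (h.monotone_left hB hs hG hd1 hβ.1 hτ.1 (hτ.2.trans_lt htT) (ha0.trans_le hβ'.1)
      (hR.trans_le hβ'.2)).2
  · have h1 := (hzero z hz).1
    have h2 := hκ z hz
    linarith
  · have h1 := hzero z hz
    have h2 := hκ z hz
    rw [L.u_eq e s]
    linarith
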